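/- Let $d\ge 1$, let $\Omega\subset\mathbb R^d$ be a bounded open set, and write $\mathbb R_+=[0,\infty)$. Let $f\in C^2(\mathbb R_+;\mathbb R)$ satisfy, for some constant $c_0>0$, $$f'<0,\qquad 0\le f''\le -c_0f',\qquad f(0)>0,\qquad \lim_{s\to\infty}f(s)=0,$$ and put $g=-f'$. Let $j\in\{0,1,2\}$. Let $H_0=L^2(\Omega)$, $H_1=H^1_0(\Omega)$, $H_2=H^2_0(\Omega)$ (spaces of complex-valued functions; $H^m_0(\Omega)$ is the closure of $C_c^\infty(\Omega)$ in $H^m(\Omega)$), with norms $\|v\|_{H_0}=\|v\|$, $\|v\|_{H_1}=\|\nabla v\|$, $\|v\|_{H_2}=\|\Delta v\|$, where $\|\cdot\|$ is the $L^2(\Omega)$ norm. Let $L_j=L^2_g(\mathbb R_+;H_j)$ be the space of measurable $\eta:\mathbb R_+\to H_j$ (modulo null sets) with $\|\eta\|_{L_j}^2=\int_0^\infty g(s)\|\eta(s)\|_{H_j}^2\,ds<\infty$, and let $\mathcal H_j=L^2(\Omega)\times L_j$ with $\|(y,\eta)\|^2=\|y\|^2+\|\eta\|_{L_j}^2$.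 Define the unbounded operator $\mathcal A_j$ on $\mathcal H_j$ by $$\mathcal A_j(y,\eta)=\Big(i\Delta y-i\Delta^2y+(-1)^{j+1}\int_0^\infty g(s)\,\Delta^j\eta(\cdot,s)\,ds,\ \ y-\partial_s\eta\Big),$$ $$D(\mathcal A_j)=\{(y,\eta)\in\mathcal H_j:\ y\in H^2_0(\Omega),\ \mathcal A_j(y,\eta)\in\mathcal H_j,\ \eta(\cdot,0)=0\},$$ where the first component is understood in the sense of distributions on $\Omega$ and $\partial_s\eta$ is the weak derivative in $s$ (so that $\eta$ is locally absolutely continuous in $s$ and $\eta(\cdot,0)$ is meaningful). Then: 1. $\mathcal A_j$ is the infinitesimal generator of a $C_0$ semigroup of bounded linear operators on $\mathcal H_j$. 2. For every integer $n\ge0$ and every $U_0\in D(\mathcal A_j^n)$, the Cauchy problem $\partial_tU=\mathcal A_jU$ on $\mathbb R_+$, $U(0)=U_0$, has a unique solution $U$ in the class $\bigcap_{k=0}^nC^k(\mathbb R_+;D(\mathcal A_j^{n-k}))$, where $D(\mathcal A_j^l)$ carries the graph norm $\big(\sum_{i\le l}\|\mathcal A_j^iU\|^2\big)^{1/2}$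 (with $\mathcal A_j^0=I$ and $D(\mathcal A_j^0)=\mathcal H_j$). For $n\ge1$ the equation holds in the classical sense for every $t\ge0$ (one-sided derivative at $t=0$); for $n=0$ it holds in the mild sense, i.e. $\int_0^tU(s)\,ds\in D(\mathcal A_j)$ and $U(t)=U_0+\mathcal A_j\int_0^tU(s)\,ds$ for all $t\ge0$. -/

import Mathlib

open MeasureTheory Set Filter Topology TopologicalSpace
open scoped Distributions ContDiff NNReal ENNReal LineDeriv InnerProductSpace

noncomputable section

namespace BiharmonicMemory

/-- A bounded open subset `Ω` of `ℝ^d`; no regularity of the boundary is required. -/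
structure BoundedDomain (d : ℕ) where
  /-- the open set -/
  toOpens : Opens (EuclideanSpace ℝ (Fin d))
  isBounded : Bornology.IsBounded (toOpens : Set (EuclideanSpace ℝ (Fin d)))

variable {d : ℕ}

/-- The complex-valued test functions on `Ω`: smooth with compact support contained in `Ω`. -/
abbrev Test (Ω : BoundedDomain d) := 𝓓(Ω.toOpens, ℂ)

/-- `L²(Ω)`, complex-valued, with the Lebesgue measure. -/
abbrev L2 (Ω : BoundedDomain d) :=
  Lp ℂ 2 ((volume : Measure (EuclideanSpace ℝ (Fin d))).restrict (Ω.toOpens : Set _))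

/-- The `i`-th vector of the standard basis of `ℝ^d`. -/
abbrev basisVec (i : Fin d) : EuclideanSpace ℝ (Fin d) := EuclideanSpace.basisFun (Fin d) ℝ i

/-- The Laplacian `Δ φ = ∑ᵢ ∂ᵢ ∂ᵢ φ` of a test function. -/
def lap (Ω : BoundedDomain d) (φ : Test Ω) : Test Ω :=
  ∑ i : Fin d, ∂_{basisVec i} (∂_{basisVec i} φ)

theorem memLp_test {Ω : BoundedDomain d} (φ : Test Ω) (p : ℝ≥0∞) :
    MemLp φ p ((volume : Measure (EuclideanSpace ℝ (Fin d))).restrict (Ω.toOpens : Set _)) :=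
  (φ.continuous.memLp_of_hasCompactSupport φ.hasCompactSupport).restrict _

/-- The class of a test function in `L²(Ω)`. -/
def testL2 (Ω : BoundedDomain d) : Test Ω →ₗ[ℂ] L2 Ω where
  toFun φ := (memLp_test φ 2).toLp φ
  map_add' φ ψ := MemLp.toLp_add (memLp_test φ 2) (memLp_test ψ 2)
  map_smul' c φ := MemLp.toLp_const_smul c (memLp_test φ 2)

/-- The partial derivatives of order at most `m`, indexed by their order `k ≤ m` and the `k`
coordinate directions in which one differentiates. -/
abbrev MultiIdx (d m : ℕ) := Σ k : Fin (m + 1), (Fin (k : ℕ) → Fin d)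

/-- The family of all partial derivatives of order at most `m` of a test function, with the norm
`(∑ ‖∂ᵃ φ‖²)^(1/2)` of the Sobolev space `H^m(Ω)`. -/
def jet (Ω : BoundedDomain d) (m : ℕ) :
    Test Ω →ₗ[ℂ] PiLp 2 (fun _ : MultiIdx d m => L2 Ω) where
  toFun φ := WithLp.toLp 2 fun a => testL2 Ω (∂^{fun i => basisVec (a.2 i)} φ)
  map_add' φ ψ := by
    ext1 a; simp [LineDeriv.iteratedLineDerivOp_add]
  map_smul' c φ := by
    ext1 a; simp [LineDeriv.iteratedLineDerivOp_smul]

/-- The Sobolev space `H^m_0(Ω)`, the closure of the test functions in `H^m(Ω)`. Its elements are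
recorded as the families `(∂ᵃ u)` of their weak derivatives of order at most `m`, the entry of
order zero being the function `u` itself. For `m = 0` this is `L²(Ω)`. -/
def sobolevZero (Ω : BoundedDomain d) (m : ℕ) :
    Submodule ℂ (PiLp 2 (fun _ : MultiIdx d m => L2 Ω)) :=
  (LinearMap.range (jet Ω m)).topologicalClosure

/-- Number of components of the differential operator `Δ^(j/2)`: one for the identity (`j = 0`),
`d` for the gradient (`j = 1`), one for the Laplacian (`j = 2`). -/
abbrev DerivIdx (d : ℕ) : Fin 3 → Type
  | 0 => Unit
  | 1 => Fin d
  | 2 => Unit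

instance (d : ℕ) (j : Fin 3) : Fintype (DerivIdx d j) :=
  match j with
  | 0 => inferInstanceAs (Fintype Unit)
  | 1 => inferInstanceAs (Fintype (Fin d))
  | 2 => inferInstanceAs (Fintype Unit)

/-- The operator `Δ^(j/2)`: identity for `j = 0`, gradient for `j = 1`, Laplacian for `j = 2`, on
families of (weak) derivatives. -/
def energyDeriv (Ω : BoundedDomain d) : (j : Fin 3) →
    PiLp 2 (fun _ : MultiIdx d j => L2 Ω) →L[ℂ] PiLp 2 (fun _ : DerivIdx d j => L2 Ω)
  | 0 => (PiLp.continuousLinearEquiv 2 ℂ _).symm.toContinuousLinearMap ∘L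
      ContinuousLinearMap.pi fun _ : Unit => PiLp.proj 2 _ (⟨0, ![]⟩ : MultiIdx d 0)
  | 1 => (PiLp.continuousLinearEquiv 2 ℂ _).symm.toContinuousLinearMap ∘L
      ContinuousLinearMap.pi fun i : Fin d => PiLp.proj 2 _ (⟨1, ![i]⟩ : MultiIdx d 1)
  | 2 => (PiLp.continuousLinearEquiv 2 ℂ _).symm.toContinuousLinearMap ∘L
      ContinuousLinearMap.pi fun _ : Unit =>
        ∑ i : Fin d, PiLp.proj 2 _ (⟨2, ![i, i]⟩ : MultiIdx d 2)

/-! ### Integration by parts and the Poincaré inequality -/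

theorem inner_testL2 {Ω : BoundedDomain d} (φ ψ : Test Ω) :
    ⟪testL2 Ω φ, testL2 Ω ψ⟫_ℂ = ∫ x, ψ x * (starRingEnd ℂ) (φ x) := by
  rw [L2.inner_def, ← setIntegral_eq_integral_of_forall_compl_eq_zero (s := (Ω.toOpens : Set _))
    (f := fun x => ψ x * (starRingEnd ℂ) (φ x))]
  · apply integral_congr_ae
    filter_upwards [(memLp_test φ 2).coeFn_toLp, (memLp_test ψ 2).coeFn_toLp] with x h1 h2
    simp only [testL2, LinearMap.coe_mk, AddHom.coe_mk, h1, h2]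
    simp [inner]
  · intro x hx
    have : φ x = 0 := image_eq_zero_of_notMem_tsupport fun h => hx (φ.tsupport_subset h)
    simp [this]

theorem lineDeriv_test {Ω : BoundedDomain d} (φ : Test Ω) (v x : EuclideanSpace ℝ (Fin d)) :
    (∂_{v} φ) x = fderiv ℝ φ x v := by
  rw [TestFunction.lineDerivOp_eq_lineDerivCLM ℝ]
  rw [TestFunction.lineDerivCLM_apply_of_le (by simp)]
  exact (φ.contDiff.differentiable (by simp)).differentiableAt.lineDeriv_eq_fderiv

theorem inner_lineDeriv {Ω : BoundedDomain d} (φ ψ : Test Ω) (v : EuclideanSpace ℝ (Fin d)) :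
    ⟪testL2 Ω (∂_{v} φ), testL2 Ω ψ⟫_ℂ = - ⟪testL2 Ω φ, testL2 Ω (∂_{v} ψ)⟫_ℂ := by
  rw [inner_testL2, inner_testL2]
  simp only [lineDeriv_test]
  have hφ : Differentiable ℝ φ := φ.contDiff.differentiable (by simp)
  have hψ : Differentiable ℝ ψ := ψ.contDiff.differentiable (by simp)
  have hs : Continuous (starRingEnd ℂ) := Complex.continuous_conj
  have hd : ∀ x, (starRingEnd ℂ) (fderiv ℝ φ x v) =
      fderiv ℝ (fun x => (starRingEnd ℂ) (φ x)) x v := by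
    intro x
    have := (Complex.conjCLE.toContinuousLinearMap.hasFDerivAt.comp x (hφ x).hasFDerivAt).fderiv
    change _ = fderiv ℝ (Complex.conjCLE.toContinuousLinearMap ∘ φ) x v
    rw [this]; rfl
  simp only [hd]
  have hcs : HasCompactSupport fun x => (starRingEnd ℂ) (φ x) :=
    φ.hasCompactSupport.comp_left (by simp)
  have hc1 : ContDiff ℝ ∞ fun x => (starRingEnd ℂ) (φ x) :=
    Complex.conjCLE.toContinuousLinearMap.contDiff.comp φ.contDiff
  have c1 : Continuous fun x => fderiv ℝ (fun x => (starRingEnd ℂ) (φ x)) x v :=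
    (hc1.continuous_fderiv (by simp)).clm_apply continuous_const
  have c2 : Continuous fun x => fderiv ℝ ψ x v :=
    (ψ.contDiff.continuous_fderiv (by simp)).clm_apply continuous_const
  rw [integral_mul_fderiv_eq_neg_fderiv_mul_of_integrable]
  · exact (c2.mul hc1.continuous).integrable_of_hasCompactSupport hcs.mul_left
  · exact (ψ.continuous.mul c1).integrable_of_hasCompactSupport ψ.hasCompactSupport.mul_right
  · exact (ψ.continuous.mul hc1.continuous).integrable_of_hasCompactSupport
      ψ.hasCompactSupport.mul_right
  · exact fun x _ => hψ x
  · exact fun x _ => hc1.differentiable (by simp) x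

theorem lineDeriv_comm {Ω : BoundedDomain d} (φ : Test Ω) (v w : EuclideanSpace ℝ (Fin d)) :
    ∂_{v} (∂_{w} φ) = ∂_{w} (∂_{v} φ) := by
  have key : ∀ (v w x : EuclideanSpace ℝ (Fin d)),
      (∂_{v} (∂_{w} φ)) x = fderiv ℝ (fderiv ℝ φ) x v w := by
    intro v w x
    rw [lineDeriv_test]
    have h1 : (⇑(∂_{w} φ : Test Ω) : EuclideanSpace ℝ (Fin d) → ℂ) = fun y => fderiv ℝ φ y w :=
      funext fun y => lineDeriv_test φ w y
    have h2 : DifferentiableAt ℝ (fderiv ℝ φ) x :=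
      ((φ.contDiff.fderiv_right (m := 1) (by norm_cast)).differentiable (by simp)) x
    rw [h1, fderiv_clm_apply h2 (differentiableAt_const w)]
    simp
  ext x
  rw [key, key]
  have := (φ.contDiff.contDiffAt (x := x)).isSymmSndFDerivAt
    (by simp only [minSmoothness_of_isRCLikeNormedField]; norm_cast)
  exact this v w


theorem poincare_test [NeZero d] (Ω : BoundedDomain d) :
    ∃ C : ℝ, 0 ≤ C ∧ ∀ φ : Test Ω,
      ‖testL2 Ω φ‖ ≤ C * ‖testL2 Ω (∂_{basisVec (0 : Fin d)} φ)‖ := by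
  obtain ⟨R, hR⟩ := Ω.isBounded.exists_norm_le
  refine ⟨2 * |R|, by positivity, fun φ => ?_⟩
  set v : EuclideanSpace ℝ (Fin d) := basisVec (0 : Fin d) with hv
  let ℓ : EuclideanSpace ℝ (Fin d) →L[ℝ] ℝ := EuclideanSpace.proj (0 : Fin d)
  have hℓv : ℓ v = 1 := by simp [ℓ, v]
  have hmul : ∀ φ : Test Ω, ∃ ψ : Test Ω, ∀ x, ψ x = (ℓ x : ℂ) * φ x := fun φ =>
    ⟨⟨fun x => (ℓ x : ℂ) * φ x,
      (Complex.ofRealCLM.contDiff.comp ℓ.contDiff).mul φ.contDiff,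
      φ.hasCompactSupport.mul_left,
      (closure_mono (Function.support_mul_subset_right _ _)).trans φ.tsupport_subset⟩,
      fun x => rfl⟩
  have hnorm : ∀ φ ψ : Test Ω, (∀ x, ψ x = (ℓ x : ℂ) * φ x) →
      ‖testL2 Ω ψ‖ ≤ |R| * ‖testL2 Ω φ‖ := by
    intro φ ψ h
    apply Lp.norm_le_mul_norm_of_ae_le_mul
    filter_upwards [(memLp_test φ 2).coeFn_toLp, (memLp_test ψ 2).coeFn_toLp,
      ae_restrict_mem Ω.toOpens.isOpen.measurableSet] with x h1 h2 hx
    simp only [testL2, LinearMap.coe_mk, AddHom.coe_mk, h1, h2, h]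
    rw [norm_mul]
    gcongr
    rw [Complex.norm_real]
    exact (PiLp.norm_apply_le x 0).trans ((hR x hx).trans (le_abs_self R))
  obtain ⟨ψ, hψ⟩ := hmul φ
  obtain ⟨χ, hχ⟩ := hmul (∂_{v} φ)
  have hdψ : ∂_{v} ψ = φ + χ := by
    ext x
    have e : (ψ : EuclideanSpace ℝ (Fin d) → ℂ) = fun y => (ℓ y : ℂ) * φ y := funext hψ
    have hφ : HasFDerivAt φ (fderiv ℝ φ x) x :=
      (φ.contDiff.differentiable (by simp)).differentiableAt.hasFDerivAt
    have hl : HasFDerivAt (fun y => (ℓ y : ℂ)) (Complex.ofRealCLM ∘L ℓ) x :=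
      (Complex.ofRealCLM ∘L ℓ).hasFDerivAt
    rw [lineDeriv_test, e]
    erw [(hl.mul hφ).fderiv]
    simp [hχ, lineDeriv_test, hℓv]
    ring
  have h1 := inner_lineDeriv ψ φ v
  rw [hdψ, map_add, inner_add_left] at h1
  have h2 : ‖testL2 Ω φ‖ ^ 2 ≤ 2 * |R| * ‖testL2 Ω (∂_{v} φ)‖ * ‖testL2 Ω φ‖ := by
    have h3 : ((‖testL2 Ω φ‖ : ℂ) ^ 2) =
        - ⟪testL2 Ω ψ, testL2 Ω (∂_{v} φ)⟫_ℂ - ⟪testL2 Ω χ, testL2 Ω φ⟫_ℂ := by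
      rw [← h1, inner_self_eq_norm_sq_to_K]; simp
    have h4 : ‖testL2 Ω φ‖ ^ 2 = ‖((‖testL2 Ω φ‖ : ℂ) ^ 2)‖ := by simp
    rw [h4, h3]
    refine (norm_sub_le _ _).trans ?_
    rw [norm_neg]
    have h5 := norm_inner_le_norm (𝕜 := ℂ) (testL2 Ω ψ) (testL2 Ω (∂_{v} φ))
    have h6 := norm_inner_le_norm (𝕜 := ℂ) (testL2 Ω χ) (testL2 Ω φ)
    have h7 := mul_le_mul_of_nonneg_right (hnorm _ _ hψ) (norm_nonneg (testL2 Ω (∂_{v} φ)))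
    have h8 := mul_le_mul_of_nonneg_right (hnorm _ _ hχ) (norm_nonneg (testL2 Ω φ))
    linarith
  rcases (norm_nonneg (testL2 Ω φ)).eq_or_lt with h0 | h0
  · rw [← h0]; positivity
  · nlinarith

theorem hessian_le_lap (Ω : BoundedDomain d) (φ : Test Ω) (a b : Fin d) :
    ‖testL2 Ω (∂_{basisVec a} (∂_{basisVec b} φ))‖ ≤ ‖testL2 Ω (lap Ω φ)‖ := by
  have key : ∀ a b : Fin d, ⟪testL2 Ω (∂_{basisVec a} (∂_{basisVec b} φ)),
      testL2 Ω (∂_{basisVec a} (∂_{basisVec b} φ))⟫_ℂ =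
      ⟪testL2 Ω (∂_{basisVec b} (∂_{basisVec b} φ)),
        testL2 Ω (∂_{basisVec a} (∂_{basisVec a} φ))⟫_ℂ := by
    intro a b
    rw [inner_lineDeriv, lineDeriv_comm φ (basisVec a) (basisVec b),
      lineDeriv_comm (∂_{basisVec a} φ) (basisVec a) (basisVec b), ← inner_lineDeriv]
  have hsum : ⟪testL2 Ω (lap Ω φ), testL2 Ω (lap Ω φ)⟫_ℂ =
      ∑ b : Fin d, ∑ a : Fin d, ⟪testL2 Ω (∂_{basisVec a} (∂_{basisVec b} φ)),
        testL2 Ω (∂_{basisVec a} (∂_{basisVec b} φ))⟫_ℂ := by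
    simp only [lap, map_sum, sum_inner, inner_sum, key]
    exact Finset.sum_comm
  have hsum' : ‖testL2 Ω (lap Ω φ)‖ ^ 2 =
      ∑ b : Fin d, ∑ a : Fin d, ‖testL2 Ω (∂_{basisVec a} (∂_{basisVec b} φ))‖ ^ 2 := by
    simp only [inner_self_eq_norm_sq_to_K] at hsum
    exact_mod_cast hsum
  refine le_of_sq_le_sq ?_ (norm_nonneg _)
  rw [hsum']
  refine le_trans ?_ (Finset.single_le_sum (fun b _ => Finset.sum_nonneg fun a _ => sq_nonneg _)
    (Finset.mem_univ b))
  exact Finset.single_le_sum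
    (f := fun a => ‖testL2 Ω (∂_{basisVec a} (∂_{basisVec b} φ))‖ ^ 2)
    (fun a _ => sq_nonneg _) (Finset.mem_univ a)

theorem jet_apply (Ω : BoundedDomain d) (m : ℕ) (φ : Test Ω) (a : MultiIdx d m) :
    jet Ω m φ a = testL2 Ω (∂^{fun i => basisVec (a.2 i)} φ) := rfl

theorem jet_bound [NeZero d] (Ω : BoundedDomain d) (j : Fin 3) :
    ∃ C : ℝ, 0 ≤ C ∧ ∀ φ : Test Ω, ∀ a, ‖jet Ω j φ a‖ ≤ C * ‖energyDeriv Ω j (jet Ω j φ)‖ := by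
  obtain ⟨C, hC, h⟩ := poincare_test Ω
  match j with
  | 0 =>
    refine ⟨1, zero_le_one, fun φ a => ?_⟩
    rw [one_mul]
    have ha : a = (⟨0, ![]⟩ : MultiIdx d 0) := by
      obtain ⟨k, a⟩ := a
      obtain rfl : k = 0 := Subsingleton.elim (α := Fin 1) _ _
      congr 1
      exact Subsingleton.elim (α := Fin 0 → Fin d) _ _
    rw [ha]
    exact PiLp.norm_apply_le (energyDeriv Ω 0 (jet Ω 0 φ)) ()
  | 1 =>
    have h1 : ∀ (φ : Test Ω) (i : Fin d),
        ‖testL2 Ω (∂_{basisVec i} φ)‖ ≤ ‖energyDeriv Ω 1 (jet Ω 1 φ)‖ := fun φ i =>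
      PiLp.norm_apply_le (energyDeriv Ω 1 (jet Ω 1 φ)) i
    refine ⟨max C 1, by positivity, fun φ a => ?_⟩
    have hN := norm_nonneg (energyDeriv Ω 1 (jet Ω 1 φ))
    obtain ⟨⟨k, hk⟩, a⟩ := a
    rw [jet_apply]
    match k, hk with
    | 0, _ =>
      refine (h φ).trans ?_
      exact mul_le_mul (le_max_left _ _) (h1 φ 0) (norm_nonneg _) (by positivity)
    | 1, _ =>
      refine (h1 φ (a 0)).trans ?_
      exact le_mul_of_one_le_left hN (le_max_right _ _)
    | k + 2, hk => exact absurd hk (by simp)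
  | 2 =>
    have h2 : ∀ (φ : Test Ω) (i k : Fin d),
        ‖testL2 Ω (∂_{basisVec i} (∂_{basisVec k} φ))‖ ≤ ‖energyDeriv Ω 2 (jet Ω 2 φ)‖ := by
      intro φ i k
      refine (hessian_le_lap Ω φ i k).trans ?_
      have : testL2 Ω (lap Ω φ) = energyDeriv Ω 2 (jet Ω 2 φ) () := by
        simp [energyDeriv, lap, jet_apply]
        rfl
      rw [this]
      exact PiLp.norm_apply_le (energyDeriv Ω 2 (jet Ω 2 φ)) ()
    refine ⟨max (C * C) (max C 1), by positivity, fun φ a => ?_⟩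
    have hN := norm_nonneg (energyDeriv Ω 2 (jet Ω 2 φ))
    obtain ⟨⟨k, hk⟩, a⟩ := a
    rw [jet_apply]
    match k, hk with
    | 0, _ =>
      refine (h φ).trans ((mul_le_mul_of_nonneg_left (h _) hC).trans ?_)
      rw [← mul_assoc]
      exact mul_le_mul (le_max_left _ _) (h2 φ 0 0) (norm_nonneg _) (by positivity)
    | 1, _ =>
      refine (h _).trans ?_
      exact mul_le_mul ((le_max_left _ _).trans (le_max_right _ _)) (h2 φ 0 (a 0))
        (norm_nonneg _) (by positivity)
    | 2, _ =>
      refine (h2 φ (a 0) (a 1)).trans ?_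
      exact le_mul_of_one_le_left hN ((le_max_right _ _).trans (le_max_right _ _))
    | k + 3, hk => exact absurd hk (by simp)

/-- The Poincaré inequality: `Δ^(j/2)` controls all derivatives of order at most `j`. -/
theorem poincare [NeZero d] (Ω : BoundedDomain d) (j : Fin 3) :
    ∃ C : ℝ, ∀ u ∈ sobolevZero Ω j, ∀ a, ‖u a‖ ≤ C * ‖energyDeriv Ω j u‖ := by
  obtain ⟨C, -, h⟩ := jet_bound Ω j
  refine ⟨C, fun u hu a => ?_⟩
  have hcl : IsClosed {u : PiLp 2 (fun _ : MultiIdx d j => L2 Ω) |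
      ‖u a‖ ≤ C * ‖energyDeriv Ω j u‖} :=
    isClosed_le (PiLp.proj (𝕜 := ℂ) 2 (fun _ : MultiIdx d j => L2 Ω) a).continuous.norm
      (continuous_const.mul (energyDeriv Ω j).continuous.norm)
  refine hcl.closure_subset_iff.2 ?_ hu
  rintro _ ⟨φ, rfl⟩
  exact h φ a


/-! ### Weak derivatives -/

theorem eq_zero_of_inner_test {Ω : BoundedDomain d} (u : L2 Ω)
    (h : ∀ φ : Test Ω, ⟪testL2 Ω φ, u⟫_ℂ = 0) : u = 0 := by
  rw [Lp.eq_zero_iff_ae_eq_zero]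
  have hint : IntegrableOn (u : EuclideanSpace ℝ (Fin d) → ℂ) (Ω.toOpens : Set _) := by
    have : IsFiniteMeasure ((volume : Measure (EuclideanSpace ℝ (Fin d))).restrict
        (Ω.toOpens : Set _)) := ⟨by simpa using Ω.isBounded.measure_lt_top⟩
    exact ((Lp.memLp u).mono_exponent (by norm_num : (1 : ℝ≥0∞) ≤ 2)).integrable le_rfl
  have := Ω.toOpens.isOpen.ae_eq_zero_of_integral_contDiff_smul_eq_zero
    (μ := (volume : Measure (EuclideanSpace ℝ (Fin d)))) (f := u) hint.locallyIntegrableOn ?_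
  · exact (ae_restrict_iff' Ω.toOpens.isOpen.measurableSet).2 this
  · intro g hg hgc hgs
    let φ : Test Ω := ⟨fun x => (g x : ℂ), Complex.ofRealCLM.contDiff.comp hg,
      hgc.comp_left (g := fun r : ℝ => (r : ℂ)) (by simp),
      (closure_mono (Function.support_comp_subset (g := fun r : ℝ => (r : ℂ)) (by simp) g)).trans
        hgs⟩
    have h1 := h φ
    rw [L2.inner_def] at h1
    rw [← h1, ← setIntegral_eq_integral_of_forall_compl_eq_zero (s := (Ω.toOpens : Set _))]
    · apply integral_congr_ae
      filter_upwards [(memLp_test φ 2).coeFn_toLp] with x h1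
      simp only [testL2, LinearMap.coe_mk, AddHom.coe_mk, h1]
      change _ = inner ℂ (g x : ℂ) (u x)
      simp [inner, mul_comm]
    · intro x hx
      have : g x = 0 := image_eq_zero_of_notMem_tsupport fun h => hx (hgs h)
      simp [this]

theorem exists_adjoint_test {Ω : BoundedDomain d} {k : ℕ}
    (v : Fin k → EuclideanSpace ℝ (Fin d)) (ψ : Test Ω) :
    ∃ ψ' : Test Ω, ∀ φ : Test Ω,
      ⟪testL2 Ω ψ, testL2 Ω (∂^{v} φ)⟫_ℂ = ⟪testL2 Ω ψ', testL2 Ω φ⟫_ℂ := by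
  induction k generalizing ψ with
  | zero => exact ⟨ψ, fun φ => rfl⟩
  | succ k ih =>
    obtain ⟨ψ', h⟩ := ih (Fin.tail v) (- ∂_{v 0} ψ)
    refine ⟨ψ', fun φ => ?_⟩
    rw [← h, LineDeriv.iteratedLineDerivOp_succ_left, map_neg, inner_neg_left, inner_lineDeriv,
      neg_neg]

theorem eq_zero_of_apply_zero {Ω : BoundedDomain d} {m : ℕ}
    (u : PiLp 2 (fun _ : MultiIdx d m => L2 Ω)) (hu : u ∈ sobolevZero Ω m)
    (h0 : u ⟨0, Fin.elim0⟩ = 0) : u = 0 := by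
  ext1 a
  refine eq_zero_of_inner_test _ fun ψ => ?_
  obtain ⟨ψ', h⟩ := exists_adjoint_test (fun i => basisVec (a.2 i)) ψ
  have key : ⟪testL2 Ω ψ, u a⟫_ℂ = ⟪testL2 Ω ψ', u ⟨0, Fin.elim0⟩⟫_ℂ := by
    have hcl : IsClosed {u : PiLp 2 (fun _ : MultiIdx d m => L2 Ω) |
        ⟪testL2 Ω ψ, u a⟫_ℂ = ⟪testL2 Ω ψ', u ⟨0, Fin.elim0⟩⟫_ℂ} :=
      isClosed_eq
        (((innerSL ℂ (testL2 Ω ψ)) ∘L PiLp.proj 2 (fun _ : MultiIdx d m => L2 Ω) a).continuous)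
        (((innerSL ℂ (testL2 Ω ψ')) ∘L
          PiLp.proj 2 (fun _ : MultiIdx d m => L2 Ω) ⟨0, Fin.elim0⟩).continuous)
    refine hcl.closure_subset_iff.2 ?_ hu
    rintro _ ⟨φ, rfl⟩
    exact h φ
  rw [key, h0, inner_zero_right]

/-! ### The spaces `H_j` -/

/-- The space `H_j`: `L²(Ω)` for `j = 0`, `H^1_0(Ω)` for `j = 1`, `H^2_0(Ω)` for `j = 2`. It is
equipped below with the inner product `⟨u, v⟩_{H_j} = ⟨Δ^(j/2) u, Δ^(j/2) v⟩`. -/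
def HSpace (Ω : BoundedDomain d) (j : Fin 3) : Type := sobolevZero Ω j

instance (Ω : BoundedDomain d) (j : Fin 3) : AddCommGroup (HSpace Ω j) :=
  inferInstanceAs (AddCommGroup (sobolevZero Ω j))

instance (Ω : BoundedDomain d) (j : Fin 3) : Module ℂ (HSpace Ω j) :=
  inferInstanceAs (Module ℂ (sobolevZero Ω j))

/-- The operator `Δ^(j/2)` on `H_j`. -/
def HSpace.deriv (Ω : BoundedDomain d) (j : Fin 3) :
    HSpace Ω j →ₗ[ℂ] PiLp 2 (fun _ : DerivIdx d j => L2 Ω) :=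
  (energyDeriv Ω j).toLinearMap ∘ₗ (sobolevZero Ω j).subtype

theorem HSpace.deriv_injective [NeZero d] (Ω : BoundedDomain d) (j : Fin 3) :
    Function.Injective (HSpace.deriv Ω j) := by
  rw [injective_iff_map_eq_zero]
  intro u hu
  obtain ⟨C, hC⟩ := poincare Ω j
  have hu' : energyDeriv Ω j u.1 = 0 := hu
  apply Subtype.ext
  ext1 a
  have := hC u.1 u.2 a
  rw [hu', norm_zero, mul_zero, norm_le_zero_iff] at this
  exact this

/-- The norm `‖u‖_{H_j} = ‖Δ^(j/2) u‖`. -/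
instance [NeZero d] (Ω : BoundedDomain d) (j : Fin 3) : NormedAddCommGroup (HSpace Ω j) :=
  NormedAddCommGroup.induced _ _ (HSpace.deriv Ω j) (HSpace.deriv_injective Ω j)

/-- The inner product `⟨u, v⟩_{H_j} = ⟨Δ^(j/2) u, Δ^(j/2) v⟩`. -/
instance [NeZero d] (Ω : BoundedDomain d) (j : Fin 3) : InnerProductSpace ℂ (HSpace Ω j) :=
  { NormedSpace.induced ℂ (HSpace Ω j) _ (HSpace.deriv Ω j) with
    inner := fun u v => ⟪HSpace.deriv Ω j u, HSpace.deriv Ω j v⟫_ℂ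
    norm_sq_eq_re_inner := fun u => norm_sq_eq_re_inner (𝕜 := ℂ) (HSpace.deriv Ω j u)
    conj_inner_symm := fun u v => inner_conj_symm _ _
    add_left := fun u v w => by rw [map_add, inner_add_left]
    smul_left := fun u v c => by rw [map_smul, inner_smul_left] }

/-- The inclusion `H_j ⊆ L²(Ω)`: forget the derivatives. -/
def HSpace.toL2 [NeZero d] (Ω : BoundedDomain d) (j : Fin 3) : HSpace Ω j →L[ℂ] L2 Ω :=
  LinearMap.mkContinuousOfExistsBound
    ((PiLp.proj 2 (fun _ : MultiIdx d j => L2 Ω) ⟨0, Fin.elim0⟩).toLinearMap ∘ₗ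
      (sobolevZero Ω j).subtype)
    (by
      obtain ⟨C, hC⟩ := poincare Ω j
      exact ⟨C, fun u => hC u.1 u.2 _⟩)

theorem HSpace.toL2_injective [NeZero d] (Ω : BoundedDomain d) (j : Fin 3) :
    Function.Injective (HSpace.toL2 Ω j) := by
  rw [injective_iff_map_eq_zero]
  intro u hu
  exact Subtype.ext (eq_zero_of_apply_zero u.1 u.2 hu)

instance [NeZero d] (Ω : BoundedDomain d) (j : Fin 3) : CompleteSpace (HSpace Ω j) := by
  have : CompleteSpace (sobolevZero Ω j) :=
    (Submodule.isClosed_topologicalClosure _).completeSpace_coe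
  let e : HSpace Ω j ≃ₗ[ℂ] sobolevZero Ω j := LinearEquiv.refl ℂ _
  have h1 : Continuous e.symm := by
    refine AddMonoidHomClass.continuous_of_bound e.symm ‖energyDeriv Ω j‖ fun u => ?_
    exact (energyDeriv Ω j).le_opNorm u.1
  have h2 : Continuous e := by
    obtain ⟨C, hC⟩ := poincare Ω j
    rw [continuous_induced_rng]
    have : Continuous fun u : HSpace Ω j => (WithLp.ofLp (e u).1) := by
      refine continuous_pi fun a => ?_
      let ea : HSpace Ω j →ₗ[ℂ] L2 Ω :=
        (PiLp.proj 2 (fun _ : MultiIdx d j => L2 Ω) a).toLinearMap ∘ₗ (sobolevZero Ω j).subtype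
      exact AddMonoidHomClass.continuous_of_bound ea C fun u => hC u.1 u.2 a
    exact (PiLp.continuous_toLp 2 _).comp this
  let E : HSpace Ω j ≃L[ℂ] sobolevZero Ω j := ⟨e, h2, h1⟩
  exact (completeSpace_congr (e := E.toEquiv) E.isUniformEmbedding).2 this

/-! ### The memory kernel -/

/-- A memory kernel: a function `f` of class `C²` on `[0, ∞)` with `f' < 0`,
`0 ≤ f'' ≤ -c₀ f'` for some `c₀ > 0`, `f(0) > 0` and `f(s) → 0` as `s → ∞`
(derivatives at `0` are one-sided; values of `f` at negative arguments play no role). -/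
structure MemoryKernel where
  /-- the kernel -/
  f : ℝ → ℝ
  contDiffOn : ContDiffOn ℝ 2 f (Ici 0)
  deriv_neg : ∀ s ∈ Ici (0 : ℝ), derivWithin f (Ici 0) s < 0
  deriv_two : ∃ c₀ : ℝ, 0 < c₀ ∧ ∀ s ∈ Ici (0 : ℝ),
    0 ≤ iteratedDerivWithin 2 f (Ici 0) s ∧
      iteratedDerivWithin 2 f (Ici 0) s ≤ -c₀ * derivWithin f (Ici 0) s
  pos_zero : 0 < f 0
  tendsto_zero : Tendsto f atTop (𝓝 0)

namespace MemoryKernel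

/-- The weight `g = -f'`. -/
def g (K : MemoryKernel) (s : ℝ) : ℝ := -derivWithin K.f (Ici 0) s

/-- The measure `g(s) ds` on `(0, ∞)`. -/
def weight (K : MemoryKernel) : Measure ℝ :=
  (volume.restrict (Ioi 0)).withDensity fun s => ENNReal.ofReal (K.g s)

theorem g_pos (K : MemoryKernel) {s : ℝ} (hs : 0 ≤ s) : 0 < K.g s :=
  neg_pos.2 (K.deriv_neg s hs)

theorem aemeasurable_g (K : MemoryKernel) :
    AEMeasurable K.g (volume.restrict (Ioi (0 : ℝ))) := by
  refine ⟨fun s => -deriv K.f s, (measurable_deriv K.f).neg, ?_⟩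
  filter_upwards [ae_restrict_mem measurableSet_Ioi] with s hs
  rw [g, derivWithin_of_mem_nhds (Ici_mem_nhds hs)]

theorem integrableOn_g (K : MemoryKernel) : IntegrableOn K.g (Ioi 0) := by
  refine Integrable.neg (integrableOn_Ioi_deriv_of_nonpos (g := K.f) (l := 0) ?_ ?_ ?_
    K.tendsto_zero)
  · exact K.contDiffOn.continuousOn 0 self_mem_Ici
  · intro x hx
    have h1 := (K.contDiffOn.differentiableOn (by simp) x (mem_Ici.2 (le_of_lt hx))).hasDerivWithinAt
    exact h1.hasDerivAt (Ici_mem_nhds hx)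
  · exact fun x hx => (K.deriv_neg x (mem_Ici.2 (le_of_lt hx))).le

instance (K : MemoryKernel) : IsFiniteMeasure K.weight := by
  refine isFiniteMeasure_withDensity_ofReal ?_
  exact K.integrableOn_g.2

theorem ae_weight_iff (K : MemoryKernel) {p : ℝ → Prop} :
    (∀ᵐ s ∂K.weight, p s) ↔ ∀ᵐ s ∂volume.restrict (Ioi (0 : ℝ)), p s := by
  rw [weight, ae_withDensity_iff' K.aemeasurable_g.ennreal_ofReal]
  constructor
  · intro h
    filter_upwards [h, ae_restrict_mem measurableSet_Ioi] with s h1 hs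
    exact h1 (by simpa using K.g_pos (le_of_lt hs))
  · intro h
    filter_upwards [h] with s h1 _ using h1

theorem integrableOn_g_mul (K : MemoryKernel) {F : ℝ → ℂ} (hF : Integrable F K.weight) :
    IntegrableOn (fun s => (K.g s : ℂ) * F s) (Ioi 0) := by
  rw [weight, integrable_withDensity_iff_integrable_smul₀' K.aemeasurable_g.ennreal_ofReal
    (by simp)] at hF
  refine hF.congr ?_
  filter_upwards [ae_restrict_mem measurableSet_Ioi] with s hs
  rw [ENNReal.toReal_ofReal (K.g_pos (le_of_lt hs)).le]
  simp

end MemoryKernel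

/-- The weighted space `L_j = L²_g(ℝ₊; H_j)`, with `‖η‖² = ∫₀^∞ g(s) ‖η(s)‖²_{H_j} ds`. -/
abbrev MemorySpace [NeZero d] (Ω : BoundedDomain d) (K : MemoryKernel) (j : Fin 3) :=
  Lp (HSpace Ω j) 2 K.weight

/-- The energy space `𝓗_j = L²(Ω) × L_j`, with `‖(y, η)‖² = ‖y‖² + ‖η‖²_{L_j}`. -/
abbrev EnergySpace [NeZero d] (Ω : BoundedDomain d) (K : MemoryKernel) (j : Fin 3) :=
  WithLp 2 (L2 Ω × MemorySpace Ω K j)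

/-- The pairing `∫_Ω u φ dx` of `u ∈ L²(Ω)`, as a distribution, with a test function. -/
def pairing {Ω : BoundedDomain d} (u : L2 Ω) (φ : Test Ω) : ℂ :=
  ∫ x in (Ω.toOpens : Set (EuclideanSpace ℝ (Fin d))), u x * φ x

/-- The complex conjugate of a test function. -/
def conjTest {Ω : BoundedDomain d} (φ : Test Ω) : Test Ω :=
  ⟨fun x => (starRingEnd ℂ) (φ x), Complex.conjCLE.toContinuousLinearMap.contDiff.comp φ.contDiff,
    φ.hasCompactSupport.comp_left (by simp),
    (closure_mono (Function.support_comp_subset (by simp) φ)).trans φ.tsupport_subset⟩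

theorem pairing_eq_inner {Ω : BoundedDomain d} (u : L2 Ω) (φ : Test Ω) :
    pairing u φ = ⟪testL2 Ω (conjTest φ), u⟫_ℂ := by
  rw [pairing, L2.inner_def]
  apply integral_congr_ae
  filter_upwards [(memLp_test (conjTest φ) 2).coeFn_toLp] with x h1
  simp only [testL2, LinearMap.coe_mk, AddHom.coe_mk, h1]
  change _ = inner ℂ ((starRingEnd ℂ) (φ x)) (u x)
  simp [inner]

theorem pairing_add {Ω : BoundedDomain d} (u v : L2 Ω) (φ : Test Ω) :
    pairing (u + v) φ = pairing u φ + pairing v φ := by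
  simp only [pairing_eq_inner, inner_add_right]

theorem pairing_smul {Ω : BoundedDomain d} (c : ℂ) (u : L2 Ω) (φ : Test Ω) :
    pairing (c • u) φ = c * pairing u φ := by
  simp only [pairing_eq_inner, inner_smul_right]

theorem eq_zero_of_pairing {Ω : BoundedDomain d} (u : L2 Ω)
    (h : ∀ φ : Test Ω, pairing u φ = 0) : u = 0 := by
  refine eq_zero_of_inner_test u fun φ => ?_
  have : conjTest (conjTest φ) = φ := by
    ext x; exact Complex.conj_conj _
  rw [← this, ← pairing_eq_inner, h]

/-- The distribution `∫₀^∞ g(s) Δ^j η(·, s) ds` on `Ω`, evaluated at a test function `φ`: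
`∫₀^∞ g(s) (∫_Ω η(x, s) Δ^j φ(x) dx) ds`. The integral converges absolutely, see
`memoryPairing_integrable`. -/
def memoryPairing [NeZero d] {Ω : BoundedDomain d} {K : MemoryKernel} {j : Fin 3}
    (η : MemorySpace Ω K j) (φ : Test Ω) : ℂ :=
  ∫ s in Ioi (0 : ℝ), (K.g s : ℂ) * pairing (HSpace.toL2 Ω j (η s)) ((lap Ω)^[(j : ℕ)] φ)

theorem memoryPairing_integrable [NeZero d] {Ω : BoundedDomain d} {K : MemoryKernel} {j : Fin 3}
    (η : MemorySpace Ω K j) (φ : Test Ω) :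
    IntegrableOn (fun s => (K.g s : ℂ) * pairing (HSpace.toL2 Ω j (η s)) φ) (Ioi 0) := by
  apply K.integrableOn_g_mul
  simp only [pairing_eq_inner]
  exact ((innerSL ℂ (testL2 Ω (conjTest φ))) ∘L HSpace.toL2 Ω j).integrable_comp
    ((Lp.memLp η).integrable (by norm_num))

theorem memoryPairing_add [NeZero d] {Ω : BoundedDomain d} {K : MemoryKernel} {j : Fin 3}
    (η ζ : MemorySpace Ω K j) (φ : Test Ω) :
    memoryPairing (η + ζ) φ = memoryPairing η φ + memoryPairing ζ φ := by
  rw [memoryPairing, memoryPairing, memoryPairing,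
    ← integral_add (memoryPairing_integrable η _) (memoryPairing_integrable ζ _)]
  apply integral_congr_ae
  filter_upwards [K.ae_weight_iff.1 (Lp.coeFn_add η ζ)] with s hs
  rw [hs, Pi.add_apply, map_add, pairing_add, mul_add]

theorem memoryPairing_smul [NeZero d] {Ω : BoundedDomain d} {K : MemoryKernel} {j : Fin 3}
    (c : ℂ) (η : MemorySpace Ω K j) (φ : Test Ω) :
    memoryPairing (c • η) φ = c * memoryPairing η φ := by
  rw [memoryPairing, memoryPairing, ← integral_const_mul]
  apply integral_congr_ae
  filter_upwards [K.ae_weight_iff.1 (Lp.coeFn_smul c η)] with s hs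
  rw [hs, Pi.smul_apply, map_smul, pairing_smul]
  ring

/-- `η : ℝ₊ → X` is (after modification on a null set) locally absolutely continuous on `[0, ∞)`,
with derivative `∂_s η = ζ` and with initial value `η(0) = 0`. -/
def HasDerivZeroTrace {X : Type*} [NormedAddCommGroup X] [NormedSpace ℝ X]
    (η ζ : ℝ → X) : Prop :=
  ∃ u : ℝ → X, (∀ᵐ s ∂volume.restrict (Ioi (0 : ℝ)), η s = u s) ∧
    (∀ s, 0 ≤ s → IntervalIntegrable ζ volume 0 s ∧ u s = u 0 + ∫ τ in (0 : ℝ)..s, ζ τ) ∧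
    u 0 = 0

theorem HasDerivZeroTrace.add {X : Type*} [NormedAddCommGroup X] [NormedSpace ℝ X]
    {η ζ η' ζ' : ℝ → X} (h : HasDerivZeroTrace η ζ) (h' : HasDerivZeroTrace η' ζ') :
    HasDerivZeroTrace (η + η') (ζ + ζ') := by
  obtain ⟨u, h1, h2, h3⟩ := h
  obtain ⟨v, k1, k2, k3⟩ := h'
  refine ⟨u + v, ?_, fun s hs => ⟨(h2 s hs).1.add (k2 s hs).1, ?_⟩, by simp [h3, k3]⟩
  · filter_upwards [h1, k1] with s a b
    simp [a, b]
  · simp only [Pi.add_apply]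
    rw [intervalIntegral.integral_add (h2 s hs).1 (k2 s hs).1, (h2 s hs).2, (k2 s hs).2]
    abel

theorem HasDerivZeroTrace.smul {X : Type*} [NormedAddCommGroup X] [NormedSpace ℂ X]
    {η ζ : ℝ → X} (c : ℂ) (h : HasDerivZeroTrace η ζ) :
    HasDerivZeroTrace (c • η) (c • ζ) := by
  obtain ⟨u, h1, h2, h3⟩ := h
  refine ⟨c • u, ?_, fun s hs => ⟨(h2 s hs).1.smul c, ?_⟩, by simp [h3]⟩
  · filter_upwards [h1] with s a
    simp [a]
  · simp only [Pi.smul_apply]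
    rw [intervalIntegral.integral_smul, (h2 s hs).2, smul_add]

theorem HasDerivZeroTrace.congr {X : Type*} [NormedAddCommGroup X] [NormedSpace ℝ X]
    {η ζ η' ζ' : ℝ → X} (h : HasDerivZeroTrace η ζ)
    (hη : ∀ᵐ s ∂volume.restrict (Ioi (0 : ℝ)), η' s = η s)
    (hζ : ∀ᵐ s ∂volume.restrict (Ioi (0 : ℝ)), ζ' s = ζ s) :
    HasDerivZeroTrace η' ζ' := by
  obtain ⟨u, h1, h2, h3⟩ := h
  refine ⟨u, ?_, fun s hs => ?_, h3⟩
  · filter_upwards [h1, hη] with s a b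
    rw [b, a]
  · have : ζ =ᵐ[volume.restrict (uIoc 0 s)] ζ' := by
      rw [uIoc_of_le hs]
      filter_upwards [ae_restrict_of_ae_restrict_of_subset Ioc_subset_Ioi_self hζ] with t ht
      exact ht.symm
    refine ⟨(h2 s hs).1.congr_ae this, ?_⟩
    rw [(h2 s hs).2, intervalIntegral.integral_congr_ae_restrict this]

theorem HasDerivZeroTrace.ae_eq_zero {X : Type*} [NormedAddCommGroup X] [NormedSpace ℝ X]
    [CompleteSpace X] {η ζ : ℝ → X} (h : HasDerivZeroTrace η ζ)
    (hη : ∀ᵐ s ∂volume.restrict (Ioi (0 : ℝ)), η s = 0) :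
    ∀ᵐ s ∂volume.restrict (Ioi (0 : ℝ)), ζ s = 0 := by
  obtain ⟨u, h1, h2, h3⟩ := h
  have hu : ∀ s, 0 ≤ s → u s = ∫ τ in (0 : ℝ)..s, ζ τ := fun s hs => by
    rw [(h2 s hs).2, h3, zero_add]
  have hcont : ContinuousOn (fun s => ∫ τ in (0 : ℝ)..s, ζ τ) (Ioi 0) := by
    intro s hs
    have hs' : (0 : ℝ) < s := hs
    have hs1 : (0 : ℝ) ≤ s + 1 := by linarith
    have hc := intervalIntegral.continuousOn_primitive_interval'
      (h2 (s + 1) hs1).1 (left_mem_uIcc)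
    rw [uIcc_of_le hs1] at hc
    exact (hc.continuousAt (Icc_mem_nhds hs' (by linarith))).continuousWithinAt
  have hzero : EqOn (fun s => ∫ τ in (0 : ℝ)..s, ζ τ) (fun _ => (0 : X)) (Ioi 0) := by
    refine Measure.eqOn_open_of_ae_eq (μ := volume) ?_ isOpen_Ioi hcont continuousOn_const
    filter_upwards [h1, hη, ae_restrict_mem measurableSet_Ioi] with s a b hs
    rw [← hu s (le_of_lt hs), ← a, b]
  rw [ae_restrict_iff' measurableSet_Ioi]
  have hall : ∀ᵐ s : ℝ, ∀ n : ℕ, s ∈ uIcc 0 (n : ℝ) → ∀ c ∈ uIcc 0 (n : ℝ),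
      HasDerivAt (fun x => ∫ t in c..x, ζ t) (ζ s) s :=
    ae_all_iff.2 fun n => (h2 n n.cast_nonneg).1.ae_hasDerivAt_integral
  filter_upwards [hall] with s hs hs0
  obtain ⟨n, hn⟩ := exists_nat_ge s
  have hd := hs n (by rw [uIcc_of_le n.cast_nonneg]; exact ⟨le_of_lt hs0, hn⟩) 0 left_mem_uIcc
  have hd0 : HasDerivAt (fun x => ∫ t in (0 : ℝ)..x, ζ t) 0 s :=
    (hasDerivAt_const s (0 : X)).congr_of_eventuallyEq
      (hzero.eventuallyEq_of_mem (Ioi_mem_nhds hs0))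
  exact hd.unique hd0

/-- `U = (y, η)` lies in the domain of `𝓐_j` and `𝓐_j U = W`, that is:
* `y ∈ H^2_0(Ω)`;
* `i Δ y - i Δ² y + (-1)^(j+1) ∫₀^∞ g(s) Δ^j η(·, s) ds`, in the sense of distributions on `Ω`, is
  the function `W₁ ∈ L²(Ω)`;
* `η` has a derivative `∂_s η`, `y - ∂_s η` is the function `W₂ ∈ L_j` (in other words,
  `∂_s η = y - W₂`), and `η(0) = 0`. -/
structure IsImage [NeZero d] {Ω : BoundedDomain d} {K : MemoryKernel} {j : Fin 3}
    (U W : EnergySpace Ω K j) : Prop where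
  mem_sobolev : U.fst ∈ Set.range (HSpace.toL2 Ω 2)
  fst_eq : ∀ φ : Test Ω, pairing W.fst φ =
    Complex.I * pairing U.fst (lap Ω φ) - Complex.I * pairing U.fst (lap Ω (lap Ω φ)) +
      (-1) ^ ((j : ℕ) + 1) * memoryPairing U.snd φ
  snd_eq : HasDerivZeroTrace (fun s => HSpace.toL2 Ω j (U.snd s))
    (fun s => U.fst - HSpace.toL2 Ω j (W.snd s))

/-- The graph of `𝓐_j`. -/
def memGraph [NeZero d] (Ω : BoundedDomain d) (K : MemoryKernel) (j : Fin 3) :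
    Submodule ℂ (EnergySpace Ω K j × EnergySpace Ω K j) where
  carrier := {p | IsImage p.1 p.2}
  zero_mem' := by
    refine ⟨⟨0, map_zero _⟩, fun φ => ?_, ?_⟩
    · have h0 : ∀ ψ : Test Ω, pairing (0 : L2 Ω) ψ = 0 := fun ψ => by
        simp [pairing_eq_inner]
      have h1 : memoryPairing (0 : MemorySpace Ω K j) φ = 0 := by
        simpa using memoryPairing_smul (K := K) (0 : ℂ) (0 : MemorySpace Ω K j) φ
      simp [h0, h1]
    · refine HasDerivZeroTrace.congr (η := 0) (ζ := 0) ⟨0, by simp,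
        fun s _ => ⟨intervalIntegrable_const (c := (0 : L2 Ω)), by simp⟩, rfl⟩ ?_ ?_ <;>
      · filter_upwards [K.ae_weight_iff.1 (Lp.coeFn_zero (HSpace Ω j) 2 K.weight)] with s hs
        simp only [Prod.fst_zero, Prod.snd_zero, WithLp.zero_fst, WithLp.zero_snd]
        rw [hs]
        simp
  add_mem' := by
    rintro ⟨U, W⟩ ⟨U', W'⟩ h h'
    refine ⟨?_, fun φ => ?_, ?_⟩
    · obtain ⟨y, hy⟩ := h.mem_sobolev
      obtain ⟨y', hy'⟩ := h'.mem_sobolev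
      exact ⟨y + y', by rw [map_add, hy, hy']; rfl⟩
    · have a := h.fst_eq φ
      have b := h'.fst_eq φ
      simp only [Prod.fst_add, Prod.snd_add, WithLp.add_fst, WithLp.add_snd, pairing_add,
        memoryPairing_add] at a b ⊢
      rw [a, b]; ring
    · refine (h.snd_eq.add h'.snd_eq).congr ?_ ?_
      · filter_upwards [K.ae_weight_iff.1 (Lp.coeFn_add U.snd U'.snd)] with s hs
        simp only [Prod.fst_add, WithLp.add_snd, Pi.add_apply]
        rw [hs, Pi.add_apply, map_add]
      · filter_upwards [K.ae_weight_iff.1 (Lp.coeFn_add W.snd W'.snd)] with s hs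
        simp only [Prod.fst_add, Prod.snd_add, WithLp.add_fst, WithLp.add_snd, Pi.add_apply]
        rw [hs, Pi.add_apply, map_add]
        abel
  smul_mem' := by
    rintro c ⟨U, W⟩ h
    refine ⟨?_, fun φ => ?_, ?_⟩
    · obtain ⟨y, hy⟩ := h.mem_sobolev
      exact ⟨c • y, by rw [map_smul, hy]; rfl⟩
    · have a := h.fst_eq φ
      simp only [Prod.smul_fst, Prod.smul_snd, WithLp.smul_fst, WithLp.smul_snd, pairing_smul,
        memoryPairing_smul] at a ⊢
      rw [a]; ring
    · refine (h.snd_eq.smul c).congr ?_ ?_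
      · filter_upwards [K.ae_weight_iff.1 (Lp.coeFn_smul c U.snd)] with s hs
        simp [hs]
      · filter_upwards [K.ae_weight_iff.1 (Lp.coeFn_smul c W.snd)] with s hs
        simp [hs, smul_sub]

/-- The operator is well defined: `W` is determined by `U`. -/
theorem memGraph_single_valued [NeZero d] (Ω : BoundedDomain d) (K : MemoryKernel) (j : Fin 3) :
    ∀ p ∈ memGraph Ω K j, p.1 = 0 → p.2 = 0 := by
  rintro ⟨U, W⟩ h (rfl : U = 0)
  have h0 : ∀ ψ : Test Ω, pairing (0 : L2 Ω) ψ = 0 := fun ψ => by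
    simp [pairing_eq_inner]
  have h1 : ∀ φ : Test Ω, memoryPairing (0 : MemorySpace Ω K j) φ = 0 := fun φ => by
    simpa using memoryPairing_smul (K := K) (0 : ℂ) (0 : MemorySpace Ω K j) φ
  have hfst : W.fst = 0 := by
    refine eq_zero_of_pairing _ fun φ => ?_
    have := h.fst_eq φ
    simpa [h0, h1] using this
  have hsnd : W.snd = 0 := by
    have hz := h.snd_eq.ae_eq_zero (by
      filter_upwards [K.ae_weight_iff.1 (Lp.coeFn_zero (HSpace Ω j) 2 K.weight)] with s hs
      simp only [WithLp.zero_snd]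
      rw [hs]
      simp)
    rw [Lp.eq_zero_iff_ae_eq_zero]
    refine K.ae_weight_iff.2 ?_
    filter_upwards [hz] with s hs
    apply HSpace.toL2_injective Ω j
    simpa using hs
  change W = 0
  exact WithLp.ofLp_injective 2 (Prod.ext hfst hsnd)

/-- The (unbounded) operator `𝓐_j (y, η) = (i Δ y - i Δ² y + (-1)^(j+1) ∫₀^∞ g(s) Δ^j η(s) ds,
y - ∂_s η)` on the energy space, whose domain consists of the `(y, η)` with `y ∈ H^2_0(Ω)` and
`η(0) = 0` for which the right-hand side lies in the energy space. -/
def opA [NeZero d] (Ω : BoundedDomain d) (K : MemoryKernel) (j : Fin 3) :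
    EnergySpace Ω K j →ₗ.[ℂ] EnergySpace Ω K j :=
  (memGraph Ω K j).toLinearPMap

/-- `(U, W)` is in the graph of `𝓐_j` exactly when `IsImage U W`. -/
theorem mem_graph_opA [NeZero d] {Ω : BoundedDomain d} {K : MemoryKernel} {j : Fin 3}
    (U W : EnergySpace Ω K j) : (U, W) ∈ (opA Ω K j).graph ↔ IsImage U W := by
  rw [opA, Submodule.toLinearPMap_graph_eq _ (memGraph_single_valued Ω K j)]
  rfl

/-! ### Semigroups, generators, and the abstract Cauchy problem -/

section Evolution

variable {X : Type*} [NormedAddCommGroup X] [NormedSpace ℂ X]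

/-- A semigroup of class `C₀` of bounded linear operators. -/
structure IsC0Semigroup (T : ℝ≥0 → X →L[ℂ] X) : Prop where
  zero : T 0 = ContinuousLinearMap.id ℂ X
  add : ∀ s t, T (s + t) = T s ∘L T t
  tendsto : ∀ x, Tendsto (fun h => T h x) (𝓝[>] 0) (𝓝 x)

/-- `A` is the infinitesimal generator of `T`: `x ∈ D(A)` and `A x = y` exactly when
`(T(h) x - x) / h → y` as `h → 0⁺`. -/
def IsGenerator (T : ℝ≥0 → X →L[ℂ] X) (A : X →ₗ.[ℂ] X) : Prop :=
  ∀ x y, (x, y) ∈ A.graph ↔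
    Tendsto (fun h : ℝ≥0 => (h : ℝ)⁻¹ • (T h x - x)) (𝓝[>] 0) (𝓝 y)

/-- The domain `D(A^n)` with its graph norm `(∑_{i ≤ n} ‖A^i x‖²)^(1/2)`. A point `x` of `D(A^n)`
is recorded as the tuple `(x, A x, …, A^n x)`; so the elements are the tuples `(w₀, …, w_n)` with
`w_i ∈ D(A)` and `A w_i = w_{i+1}` for `i < n`. For `n = 0` this is `X`. -/
def GraphPow (A : X →ₗ.[ℂ] X) (n : ℕ) : Submodule ℂ (PiLp 2 fun _ : Fin (n + 1) => X) where
  carrier := {w | ∀ i : Fin n, (w i.castSucc, w i.succ) ∈ A.graph}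
  zero_mem' := fun _ => A.graph.zero_mem
  add_mem' := fun hv hw i => A.graph.add_mem (hv i) (hw i)
  smul_mem' := fun c _ hw i => A.graph.smul_mem c (hw i)

/-- The inclusion `D(A^n) ⊆ X`. -/
def GraphPow.toX {A : X →ₗ.[ℂ] X} {n : ℕ} (w : GraphPow A n) : X := w.1 0

/-- The domain `D(A^n)` as a subset of `X`. -/
def domPow (A : X →ₗ.[ℂ] X) (n : ℕ) : Set X :=
  Set.range (GraphPow.toX : GraphPow A n → X)

/-- The class `⋂_{k=0}^n C^k(ℝ₊; D(A^{n-k}))` of functions on `ℝ₊ = [0, ∞)`, where `D(A^l)` carries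
the graph norm (derivatives at `0` are one-sided; values at negative times play no role). -/
def InSmoothClass (A : X →ₗ.[ℂ] X) (n : ℕ) (U : ℝ → X) : Prop :=
  ∀ k l : ℕ, k + l = n → ∃ V : ℝ → GraphPow A l,
    ContDiffOn ℝ k V (Ici 0) ∧ ∀ t, 0 ≤ t → GraphPow.toX (V t) = U t

/-- Classical solution of `U' = A U` on `[0, ∞)`, `U(0) = U₀`. -/
structure IsClassicalSolution (A : X →ₗ.[ℂ] X) (U₀ : X) (U : ℝ → X) : Prop where
  initial : U 0 = U₀
  deriv : ∀ t, 0 ≤ t → ∃ W, (U t, W) ∈ A.graph ∧ HasDerivWithinAt U W (Ici 0) t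

/-- Mild solution of `U' = A U` on `[0, ∞)`, `U(0) = U₀`: the function `U` is continuous and
`∫₀ᵗ U(s) ds ∈ D(A)`, `U(t) = U₀ + A ∫₀ᵗ U(s) ds` for all `t ≥ 0`. -/
structure IsMildSolution (A : X →ₗ.[ℂ] X) (U₀ : X) (U : ℝ → X) : Prop where
  continuousOn : ContinuousOn U (Ici 0)
  integrated : ∀ t, 0 ≤ t → (∫ s in (0 : ℝ)..t, U s, U t - U₀) ∈ A.graph

/-- Solution of `U' = A U`, `U(0) = U₀` for a datum `U₀ ∈ D(A^n)`: in the mild sense if `n = 0`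
(functions of class `C(ℝ₊; X)` need be neither differentiable nor `D(A)`-valued), in the classical
sense if `n ≥ 1`. -/
def IsSolution (A : X →ₗ.[ℂ] X) : ℕ → X → (ℝ → X) → Prop
  | 0 => IsMildSolution A
  | _ + 1 => IsClassicalSolution A

end Evolution

end BiharmonicMemory

end

open BiharmonicMemory

/-! The operator is maximal dissipative for the given inner product of the energy space, so it
generates a semigroup of contractions; the Cauchy problem is then solved by orbits, and uniqueness
comes from decay of the norm.

Dissipativity. Let `C` embed `H_2` into `L_j` as functions constant in `s`. Testing the first
component with `y` itself, the terms from `i Δ` and `-i Δ²` are purely imaginary. The memory term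
contributes `-⟨C y, η⟩` and the source `y` in the second component contributes `⟨η, C y⟩`, so their
real parts cancel. What remains is `-∂ₛ` with zero trace, which is dissipative because the weight
`g` is nonincreasing (`isDissipative_derivGraph`). The signs `(-1)^(j+1)` and the three cases of `j`
disappear once `isImage_iff_isCoupledImage` rewrites the operator weakly as `w = -i (S* S y + y) -
C* η`, where `S` is the inclusion of `H_2` in `H_1`.

Range. To solve `l U - W = Z`, the memory variable is eliminated with the resolvent of `-∂ₛ`, an
explicit exponential convolution (`exists_mem_derivGraph`). There remains one equation for `y` in
`H_2`; after multiplication by `i` it is coercive for large `l`, and a Lax–Milgram argument solves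
it (`exists_isCoupledImage`).

Generation. Exponentials of Yosida approximations form a Cauchy sequence on the domain, by a Hilbert
space estimate that uses dissipativity alone (`norm_yosidaExp_sub_sq_le`). The domain is dense and
the limit semigroup has exactly this generator (`dense_domain`, `IsGenerator.of_le`).

Cauchy problem. A power of the operator in the domain buys one derivative of the orbit
(`contDiffOn_orbit`). The difference of two classical solutions has nonincreasing norm; for mild
solutions the same is applied to the primitive of the difference. -/

noncomputable section

namespace BiharmonicMemory

/-! ### Dissipative relations -/

section Dissipative

variable {X : Type*} [NormedAddCommGroup X] [InnerProductSpace ℂ X]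

/-- A linear relation `G` is dissipative if `Re ⟨x, y⟩ ≤ 0` for all `(x, y) ∈ G`. -/
def IsDissipative (G : Submodule ℂ (X × X)) : Prop :=
  ∀ x y, (x, y) ∈ G → (⟪x, y⟫_ℂ).re ≤ 0

/-- The derivative of `‖u‖²` is `2 Re ⟨u, u'⟩`. With `M = 0` this gives contractivity and
uniqueness; with `M > 0` it compares two Yosida approximations. -/
theorem norm_sq_le_of_re_inner_le {u u' : ℝ → X} {M : ℝ}
    (hu : ∀ t, 0 ≤ t → HasDerivWithinAt u (u' t) (Ici 0) t)
    (h : ∀ t, 0 ≤ t → (⟪u t, u' t⟫_ℂ).re ≤ M) {t : ℝ} (ht : 0 ≤ t) :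
    ‖u t‖ ^ 2 ≤ ‖u 0‖ ^ 2 + 2 * M * t := by
  have hd : ∀ s, 0 ≤ s → HasDerivWithinAt (fun s => ‖u s‖ ^ 2 - 2 * M * s)
      (2 * (⟪u s, u' s⟫_ℂ).re - 2 * M) (Ici 0) s := by
    intro s hs
    have h1 := (hu s hs).inner ℂ (hu s hs)
    have h2 := Complex.reCLM.hasFDerivAt.comp_hasDerivWithinAt s h1
    have h3 : HasDerivWithinAt (fun s => ‖u s‖ ^ 2) (2 * (⟪u s, u' s⟫_ℂ).re) (Ici 0) s := by
      have e : (fun s => ‖u s‖ ^ 2) = Complex.reCLM ∘ fun s => ⟪u s, u s⟫_ℂ :=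
        funext fun s => norm_sq_eq_re_inner (𝕜 := ℂ) (u s)
      rw [e]
      refine h2.congr_deriv ?_
      simp only [Complex.reCLM_apply, Complex.add_re]
      rw [two_mul, ← inner_conj_symm (u' s) (u s), Complex.conj_re]
    exact (h3.sub ((hasDerivWithinAt_id s (Ici 0)).const_mul (2 * M))).congr_deriv (by ring)
  have hanti : AntitoneOn (fun s => ‖u s‖ ^ 2 - 2 * M * s) (Ici 0) := by
    refine antitoneOn_of_deriv_nonpos (convex_Ici 0)
      (fun s hs => (hd s hs).continuousWithinAt) (fun s hs => ?_) (fun s hs => ?_)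
    · rw [interior_Ici] at hs
      exact ((hd s (le_of_lt hs)).hasDerivAt (Ici_mem_nhds hs)).differentiableAt.differentiableWithinAt
    · rw [interior_Ici] at hs
      rw [((hd s (le_of_lt hs)).hasDerivAt (Ici_mem_nhds hs)).deriv]
      linarith [h s (le_of_lt hs)]
  have := hanti self_mem_Ici (mem_Ici.2 ht) ht
  simp only [mul_zero, sub_zero] at this
  linarith

theorem norm_le_of_re_inner_nonpos {u u' : ℝ → X}
    (hu : ∀ t, 0 ≤ t → HasDerivWithinAt u (u' t) (Ici 0) t)
    (h : ∀ t, 0 ≤ t → (⟪u t, u' t⟫_ℂ).re ≤ 0) {t : ℝ} (ht : 0 ≤ t) : ‖u t‖ ≤ ‖u 0‖ := by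
  have := norm_sq_le_of_re_inner_le hu h ht
  exact le_of_sq_le_sq (by linarith) (norm_nonneg _)

/-- Pair `l x - y` with `x`: dissipativity leaves at least `l ‖x‖²`, and Cauchy–Schwarz does the
rest. -/
theorem IsDissipative.mul_norm_le {G : Submodule ℂ (X × X)} (hG : IsDissipative G) {x y : X}
    (h : (x, y) ∈ G) (l : ℝ) : l * ‖x‖ ≤ ‖(l : ℂ) • x - y‖ := by
  rcases (norm_nonneg x).eq_or_lt with h0 | h0
  · rw [← h0, mul_zero]; exact norm_nonneg _
  have h1 : (⟪x, (l : ℂ) • x - y⟫_ℂ).re = l * ‖x‖ ^ 2 - (⟪x, y⟫_ℂ).re := by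
    rw [inner_sub_right, inner_smul_right, Complex.sub_re, Complex.re_ofReal_mul,
      norm_sq_eq_re_inner (𝕜 := ℂ) x]
    rfl
  have h2 := (Complex.re_le_norm _).trans (norm_inner_le_norm (𝕜 := ℂ) x ((l : ℂ) • x - y))
  have h3 := hG x y h
  nlinarith

/-- The lower bound on `l x - y` makes the solution `x` unique, hence linear in the datum. Scaling
the datum by `l` turns the resolvent into a contraction `l (l - G)⁻¹`. The relation need not be
single-valued. -/
theorem IsDissipative.exists_resolvent {G : Submodule ℂ (X × X)} (hG : IsDissipative G) {l : ℝ}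
    (hl : 0 < l) (hR : ∀ z, ∃ x y, (x, y) ∈ G ∧ (l : ℂ) • x - y = z) :
    ∃ J : X →L[ℂ] X, (∀ z, ‖J z‖ ≤ ‖z‖) ∧ (∀ z, (J z, (l : ℂ) • (J z - z)) ∈ G) ∧
      ∀ x y, (x, y) ∈ G → ∀ z, (l : ℂ) • x - y = (l : ℂ) • z → J z = x := by
  have hbound : ∀ x y, (x, y) ∈ G → ∀ z, (l : ℂ) • x - y = (l : ℂ) • z → ‖x‖ ≤ ‖z‖ := by
    intro x y h z hz
    have := hG.mul_norm_le h l
    rw [hz, norm_smul, Complex.norm_real, Real.norm_of_nonneg hl.le] at this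
    exact le_of_mul_le_mul_left this hl
  have huniq : ∀ x y x' y', (x, y) ∈ G → (x', y') ∈ G →
      (l : ℂ) • x - y = (l : ℂ) • x' - y' → x = x' := by
    intro x y x' y' h h' e
    have := hbound (x - x') (y - y') (G.sub_mem h h') 0 (by
      rw [smul_zero, smul_sub, sub_sub_sub_comm, e, sub_self])
    simpa [sub_eq_zero] using this
  choose f g hfg hz using hR
  have key : ∀ x y, (x, y) ∈ G → ∀ z, (l : ℂ) • x - y = (l : ℂ) • z → f ((l : ℂ) • z) = x :=
    fun x y h z e => huniq _ _ _ _ (hfg _) h ((hz _).trans e.symm)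
  let J : X →ₗ[ℂ] X :=
    { toFun := fun z => f ((l : ℂ) • z)
      map_add' := fun z w => key _ _ (G.add_mem (hfg ((l : ℂ) • z)) (hfg ((l : ℂ) • w))) _ (by
        rw [smul_add, smul_add, add_sub_add_comm, hz, hz])
      map_smul' := fun c z => key _ _ (G.smul_mem c (hfg ((l : ℂ) • z))) _ (by
        rw [smul_comm (l : ℂ) c z, ← hz ((l : ℂ) • z), smul_comm (l : ℂ) c, ← smul_sub, hz]) }
  have hJ : ∀ z, ‖J z‖ ≤ 1 * ‖z‖ := fun z => by
    rw [one_mul]; exact hbound _ _ (hfg _) _ (hz _)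
  refine ⟨J.mkContinuous 1 hJ, fun z => ?_, fun z => ?_, key⟩
  · simpa using hJ z
  · have h1 := hfg ((l : ℂ) • z)
    have h2 : g ((l : ℂ) • z) = (l : ℂ) • (f ((l : ℂ) • z) - z) := by
      rw [smul_sub]; nth_rewrite 3 [← hz ((l : ℂ) • z)]; abel
    rw [h2] at h1
    exact h1

end Dissipative

/-! ### The Yosida approximation -/

section Yosida

variable {X : Type*} [NormedAddCommGroup X] [InnerProductSpace ℂ X]

/-- `J` is the (scaled) resolvent `l (l - G)⁻¹` of the relation `G`, and a contraction. -/
structure IsResolvent (G : Submodule ℂ (X × X)) (l : ℝ) (J : X →L[ℂ] X) : Prop where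
  pos : 0 < l
  norm_le : ∀ z, ‖J z‖ ≤ ‖z‖
  mem : ∀ z, (J z, (l : ℂ) • (J z - z)) ∈ G
  apply_eq : ∀ x y, (x, y) ∈ G → ∀ z, (l : ℂ) • x - y = (l : ℂ) • z → J z = x

/-- The Yosida approximation `l (J - 1)`. -/
def yosida (l : ℝ) (J : X →L[ℂ] X) : X →L[ℂ] X := (l : ℂ) • (J - 1)

theorem yosida_apply (l : ℝ) (J : X →L[ℂ] X) (z : X) : yosida l J z = (l : ℂ) • (J z - z) := rfl

/-- The uniformly continuous group generated by the Yosida approximation. -/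
def yosidaExp (l : ℝ) (J : X →L[ℂ] X) (t : ℝ) : X →L[ℂ] X := NormedSpace.exp (t • yosida l J)

variable {G : Submodule ℂ (X × X)} {l m : ℝ} {J K : X →L[ℂ] X}

namespace IsResolvent

theorem re_inner_yosida (h : IsResolvent G l J) (z : X) : (⟪z, yosida l J z⟫_ℂ).re ≤ 0 := by
  rw [yosida_apply, inner_smul_right, Complex.re_ofReal_mul, inner_sub_right, Complex.sub_re]
  have h1 := (Complex.re_le_norm _).trans (norm_inner_le_norm (𝕜 := ℂ) z (J z))
  have h2 : (⟪z, z⟫_ℂ).re = ‖z‖ ^ 2 := (norm_sq_eq_re_inner (𝕜 := ℂ) z).symm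
  have h3 := mul_le_mul_of_nonneg_left (h.norm_le z) (norm_nonneg z)
  exact mul_nonpos_of_nonneg_of_nonpos h.pos.le (by nlinarith)

/-- Follows from `x = J (x - l⁻¹ y)`. It bounds the Yosida approximation at a point of the domain by
`‖y‖`, uniformly in `l`. -/
theorem yosida_eq (h : IsResolvent G l J) {x y : X} (hxy : (x, y) ∈ G) : yosida l J x = J y := by
  have hl : (l : ℂ) ≠ 0 := by exact_mod_cast h.pos.ne'
  have := h.apply_eq x y hxy (x - (l : ℂ)⁻¹ • y) (by rw [smul_sub, smul_inv_smul₀ hl])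
  rw [map_sub, map_smul] at this
  rw [yosida_apply, sub_eq_iff_eq_add.1 this, add_sub_cancel_left, smul_inv_smul₀ hl]

/-- Trades `z` for `J z`, which is in the domain of `G`, at the price of an error of order `l⁻¹`. -/
theorem eq_sub_yosida (h : IsResolvent G l J) (z : X) : z = J z - (l : ℂ)⁻¹ • yosida l J z := by
  have hl : (l : ℂ) ≠ 0 := by exact_mod_cast h.pos.ne'
  rw [yosida_apply, inv_smul_smul₀ hl, sub_sub_cancel]

end IsResolvent

theorem yosidaExp_zero (l : ℝ) (J : X →L[ℂ] X) : yosidaExp l J 0 = 1 := by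
  rw [yosidaExp, zero_smul, NormedSpace.exp_zero]

theorem tendsto_zero_of_dense {ι : Type*} {L : Filter ι} {F : ι → X →L[ℂ] X} {C : ℝ}
    (hF : ∀ i z, ‖F i z‖ ≤ C * ‖z‖) {S : Set X} (hS : Dense S)
    (h : ∀ z ∈ S, Tendsto (fun i => F i z) L (𝓝 0)) (z : X) :
    Tendsto (fun i => F i z) L (𝓝 0) := by
  rw [Metric.tendsto_nhds]
  intro ε hε
  -- The replacement of `C` by `|C| + 1` only makes the divisor positive.
  have hC : 0 < |C| + 1 := by positivity
  obtain ⟨w, hw, hzw⟩ := Metric.dense_iff.1 hS z (ε / 2 / (|C| + 1)) (by positivity)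
  filter_upwards [Metric.tendsto_nhds.1 (h w hzw) (ε / 2) (by positivity)] with i hi
  rw [dist_zero_right] at hi ⊢
  have h1 : ‖F i (z - w)‖ < ε / 2 := by
    refine (hF i _).trans_lt ?_
    have h2 : ‖z - w‖ < ε / 2 / (|C| + 1) := by rw [← dist_eq_norm, dist_comm]; exact hw
    rw [lt_div_iff₀ hC] at h2
    nlinarith [le_abs_self C, norm_nonneg (z - w)]
  have h3 : F i z = F i (z - w) + F i w := by rw [map_sub, sub_add_cancel]
  rw [h3]
  exact (norm_add_le _ _).trans_lt (by linarith)

variable [CompleteSpace X]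

theorem yosidaExp_add (l : ℝ) (J : X →L[ℂ] X) (s t : ℝ) :
    yosidaExp l J (s + t) = yosidaExp l J s * yosidaExp l J t := by
  have : NormedAlgebra ℚ (X →L[ℂ] X) := NormedAlgebra.restrictScalars ℚ ℂ _
  rw [yosidaExp, add_smul]
  exact NormedSpace.exp_add_of_commute (((Commute.refl _).smul_left s).smul_right t)

/-- The derivative of the exponential can be written with the generator on either side; uniqueness
of derivatives identifies the two. -/
theorem yosidaExp_comm (l : ℝ) (J : X →L[ℂ] X) (t : ℝ) (z : X) :
    yosida l J (yosidaExp l J t z) = yosidaExp l J t (yosida l J z) := by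
  have h1 := hasDerivAt_exp_smul_const (𝕂 := ℝ) (yosida l J) t
  have h2 := hasDerivAt_exp_smul_const' (𝕂 := ℝ) (yosida l J) t
  exact (DFunLike.congr_fun (h1.unique h2) z).symm

theorem hasDerivAt_yosidaExp (l : ℝ) (J : X →L[ℂ] X) (t : ℝ) (z : X) :
    HasDerivAt (fun t => yosidaExp l J t z) (yosida l J (yosidaExp l J t z)) t := by
  have h2 := hasDerivAt_exp_smul_const' (𝕂 := ℝ) (yosida l J) t
  have h3 := (((ContinuousLinearMap.apply ℂ X z).restrictScalars ℝ).hasFDerivAt).comp_hasDerivAt t h2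
  exact h3

namespace IsResolvent

theorem norm_yosidaExp_le (h : IsResolvent G l J) {t : ℝ} (ht : 0 ≤ t) (z : X) :
    ‖yosidaExp l J t z‖ ≤ ‖z‖ := by
  have := norm_le_of_re_inner_nonpos
    (fun t _ => (hasDerivAt_yosidaExp l J t z).hasDerivWithinAt)
    (fun t _ => h.re_inner_yosida _) ht
  simpa [yosidaExp_zero] using this

theorem norm_yosida_yosidaExp_le (h : IsResolvent G l J) {t : ℝ} (ht : 0 ≤ t) {x y : X}
    (hxy : (x, y) ∈ G) : ‖yosida l J (yosidaExp l J t x)‖ ≤ ‖y‖ := by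
  rw [yosidaExp_comm, h.yosida_eq hxy]
  exact (h.norm_yosidaExp_le ht _).trans (h.norm_le y)

/-- Write `u`, `v` for the two orbits and `u'`, `v'` for their derivatives. Since `(J u, u')` and
`(K v, v')` lie in `G`, the pairing of `J u - K v` with `u' - v'` has nonpositive real part.
Replacing `J u - K v` by `u - v` costs `l⁻¹ u' - m⁻¹ v'`, and both derivatives are bounded by `‖y‖`.
No commutation between `J` and `K` is needed. -/
theorem norm_yosidaExp_sub_sq_le (hG : IsDissipative G) (h : IsResolvent G l J)
    (k : IsResolvent G m K) {t : ℝ} (ht : 0 ≤ t) {x y : X} (hxy : (x, y) ∈ G) :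
    ‖yosidaExp l J t x - yosidaExp m K t x‖ ^ 2 ≤ 4 * ‖y‖ ^ 2 * (l⁻¹ + m⁻¹) * t := by
  have := norm_sq_le_of_re_inner_le (M := 2 * ‖y‖ ^ 2 * (l⁻¹ + m⁻¹))
    (fun t _ => ((hasDerivAt_yosidaExp l J t x).sub
      (hasDerivAt_yosidaExp m K t x)).hasDerivWithinAt) (fun t ht => ?_) ht
  · simp only [Pi.sub_apply, yosidaExp_zero, sub_self, norm_zero] at this
    refine this.trans_eq ?_
    ring
  · simp only [Pi.sub_apply]
    set u := yosidaExp l J t x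
    set v := yosidaExp m K t x
    set u' := yosida l J u with hu'
    set v' := yosida m K v with hv'
    have e : u - v = (J u - K v) - ((l : ℂ)⁻¹ • u' - (m : ℂ)⁻¹ • v') := by
      conv_lhs => rw [h.eq_sub_yosida u, k.eq_sub_yosida v]
      abel
    have h1 : (⟪J u - K v, u' - v'⟫_ℂ).re ≤ 0 := hG _ _ (G.sub_mem (h.mem u) (k.mem v))
    have bu : ‖u'‖ ≤ ‖y‖ := h.norm_yosida_yosidaExp_le ht hxy
    have bv : ‖v'‖ ≤ ‖y‖ := k.norm_yosida_yosidaExp_le ht hxy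
    have h2 : ‖(l : ℂ)⁻¹ • u' - (m : ℂ)⁻¹ • v'‖ ≤ (l⁻¹ + m⁻¹) * ‖y‖ := by
      refine (norm_sub_le _ _).trans ?_
      rw [norm_smul, norm_smul, norm_inv, norm_inv, Complex.norm_real, Complex.norm_real,
        Real.norm_of_nonneg h.pos.le, Real.norm_of_nonneg k.pos.le, add_mul]
      have := h.pos
      have := k.pos
      gcongr
    have h3 : ‖u' - v'‖ ≤ 2 * ‖y‖ := (norm_sub_le _ _).trans (by linarith)
    have h4 := (neg_le_abs _).trans ((Complex.abs_re_le_norm _).trans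
      (norm_inner_le_norm (𝕜 := ℂ) ((l : ℂ)⁻¹ • u' - (m : ℂ)⁻¹ • v') (u' - v')))
    have h5 : 0 ≤ (l⁻¹ + m⁻¹) * ‖y‖ := (norm_nonneg _).trans h2
    have h6 := mul_le_mul h2 h3 (norm_nonneg _) h5
    rw [e, inner_sub_left, Complex.sub_re]
    nlinarith

end IsResolvent

end Yosida

/-! ### The Hille–Yosida theorem for dissipative operators on a Hilbert space -/

section HilleYosida

variable {X : Type*} [NormedAddCommGroup X]

section Semigroup

variable [NormedSpace ℂ X] {T : ℝ≥0 → X →L[ℂ] X}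

theorem IsC0Semigroup.apply_add (h : IsC0Semigroup T) (s t : ℝ≥0) (x : X) :
    T (s + t) x = T s (T t x) := by rw [h.add]; rfl

theorem IsC0Semigroup.apply_zero (h : IsC0Semigroup T) (x : X) : T 0 x = x := by
  rw [h.zero]; rfl

/-- For contractions the increment over `[s, s + r]` is at most the increment over `[0, r]`, so
continuity at `0` spreads to both sides of every time. -/
theorem IsC0Semigroup.continuous (h : IsC0Semigroup T) (hT : ∀ t x, ‖T t x‖ ≤ ‖x‖) (x : X) :
    Continuous fun t => T t x := by
  have h0 : Tendsto (fun t => ‖T t x - x‖) (𝓝 0) (𝓝 0) := by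
    have hc : ContinuousWithinAt (fun t => T t x) (Ioi 0) 0 := by
      have := h.tendsto x
      rwa [ContinuousWithinAt, h.apply_zero]
    -- In `ℝ≥0` a right limit at `0` is already a full limit.
    rw [continuousWithinAt_Ioi_iff_Ici, show Ici (0 : ℝ≥0) = univ from Ici_bot,
      continuousWithinAt_univ, ContinuousAt, h.apply_zero] at hc
    simpa using (hc.sub_const x).norm
  have hle : ∀ s r : ℝ≥0, ‖T (s + r) x - T s x‖ ≤ ‖T r x - x‖ := fun s r => by
    rw [h.apply_add, ← map_sub]; exact hT _ _
  rw [continuous_iff_continuousAt]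
  intro t
  rw [ContinuousAt, tendsto_iff_norm_sub_tendsto_zero]
  have hd : Tendsto (fun s => nndist s t) (𝓝 t) (𝓝 0) := by
    have : Continuous fun s => nndist s t := continuous_id.nndist continuous_const
    simpa using this.tendsto t
  refine squeeze_zero (fun _ => norm_nonneg _) (fun s => ?_) (h0.comp hd)
  rcases le_total t s with hts | hts
  · obtain ⟨r, rfl⟩ := exists_add_of_le hts
    have : nndist (t + r) t = r := by
      apply NNReal.coe_injective
      simp [NNReal.dist_eq]
    simpa [this] using hle t r
  · obtain ⟨r, rfl⟩ := exists_add_of_le hts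
    have : nndist s (s + r) = r := by
      apply NNReal.coe_injective
      simp [NNReal.dist_eq]
    rw [norm_sub_rev]
    simpa [this] using hle s r

theorem IsC0Semigroup.continuous_toNNReal (h : IsC0Semigroup T) (hT : ∀ t x, ‖T t x‖ ≤ ‖x‖)
    (x : X) : Continuous fun t : ℝ => T t.toNNReal x :=
  (h.continuous hT x).comp continuous_real_toNNReal

end Semigroup

variable [InnerProductSpace ℂ X]

/-- If `z = l x - y` is orthogonal to the domain, pairing with `x` gives `l ‖x‖² ≤ 0`. Hence `x =
0`, then `y = 0` because `A` is single-valued, and `z = 0`. -/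
theorem IsDissipative.dense_domain [CompleteSpace X] {A : X →ₗ.[ℂ] X}
    (hA : IsDissipative A.graph) {l : ℝ} (hl : 0 < l)
    (hR : ∀ z, ∃ x y, (x, y) ∈ A.graph ∧ (l : ℂ) • x - y = z) :
    Dense {x | ∃ y, (x, y) ∈ A.graph} := by
  have hS : {x | ∃ y, (x, y) ∈ A.graph} =
      (A.graph.map (LinearMap.fst ℂ X X) : Submodule ℂ X) := by
    ext x
    simp only [mem_ofPred_eq, Submodule.map_coe, mem_image, SetLike.mem_coe, Prod.exists]
    exact ⟨fun ⟨y, h⟩ => ⟨x, y, h, rfl⟩, by rintro ⟨_, y, h, rfl⟩; exact ⟨y, h⟩⟩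
  rw [hS, Submodule.dense_iff_topologicalClosure_eq_top, Submodule.topologicalClosure_eq_top_iff,
    Submodule.eq_bot_iff]
  intro z hz
  obtain ⟨x, y, hxy, e⟩ := hR z
  have h1 : ⟪x, z⟫_ℂ = 0 := (Submodule.mem_orthogonal _ _).1 hz x ⟨(x, y), hxy, rfl⟩
  have h2 : l * ‖x‖ ^ 2 - (⟪x, y⟫_ℂ).re = 0 := by
    rw [← e, inner_sub_right, inner_smul_right] at h1
    have := congrArg Complex.re h1
    rw [Complex.sub_re, Complex.re_ofReal_mul] at this
    rw [norm_sq_eq_re_inner (𝕜 := ℂ) x]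
    exact this
  have h3 := hA x y hxy
  have hx : x = 0 := by
    have : ‖x‖ ^ 2 ≤ 0 := by
      by_contra hc
      nlinarith [mul_pos hl (not_le.1 hc)]
    exact norm_eq_zero.1 (pow_eq_zero_iff two_ne_zero |>.1 (le_antisymm this (sq_nonneg _)))
  subst hx
  rw [← e, A.graph_fst_eq_zero_snd hxy rfl, smul_zero, sub_zero]

/-- Difference quotients of a contraction are dissipative, so the true generator is a dissipative
extension of `A`. As `l - A` is onto, no proper dissipative extension exists. -/
theorem IsGenerator.of_le {A : X →ₗ.[ℂ] X} {T : ℝ≥0 → X →L[ℂ] X} (hT : ∀ t x, ‖T t x‖ ≤ ‖x‖)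
    {l : ℝ} (hl : 0 < l) (hR : ∀ z, ∃ x y, (x, y) ∈ A.graph ∧ (l : ℂ) • x - y = z)
    (h : ∀ x y, (x, y) ∈ A.graph →
      Tendsto (fun h : ℝ≥0 => (h : ℝ)⁻¹ • (T h x - x)) (𝓝[>] 0) (𝓝 y)) :
    IsGenerator T A := by
  refine fun x y => ⟨h x y, fun hxy => ?_⟩
  obtain ⟨u, v, huv, e⟩ := hR ((l : ℂ) • x - y)
  have hw := hxy.sub (h u v huv)
  have hre : (⟪x - u, y - v⟫_ℂ).re ≤ 0 := by
    have h1 : Tendsto (fun h : ℝ≥0 => (⟪x - u, (h : ℝ)⁻¹ • (T h x - x) -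
        (h : ℝ)⁻¹ • (T h u - u)⟫_ℂ).re) (𝓝[>] 0) (𝓝 (⟪x - u, y - v⟫_ℂ).re) :=
      (Complex.continuous_re.tendsto _).comp (tendsto_const_nhds.inner hw)
    refine le_of_tendsto h1 (Eventually.of_forall fun h => ?_)
    have h2 : (h : ℝ)⁻¹ • (T h x - x) - (h : ℝ)⁻¹ • (T h u - u) =
        (((h : ℝ)⁻¹ : ℝ) : ℂ) • (T h (x - u) - (x - u)) := by
      rw [Complex.coe_smul, ← smul_sub, map_sub]
      congr 1
      abel
    rw [h2, inner_smul_right, Complex.re_ofReal_mul, inner_sub_right, Complex.sub_re]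
    have h3 := (Complex.re_le_norm _).trans (norm_inner_le_norm (𝕜 := ℂ) (x - u) (T h (x - u)))
    have h4 : (⟪x - u, x - u⟫_ℂ).re = ‖x - u‖ ^ 2 := (norm_sq_eq_re_inner (𝕜 := ℂ) _).symm
    have h5 := mul_le_mul_of_nonneg_left (hT h (x - u)) (norm_nonneg (x - u))
    exact mul_nonpos_of_nonneg_of_nonpos (by positivity) (by nlinarith)
  have hv : y - v = (l : ℂ) • (x - u) := by
    rw [← sub_eq_zero] at e ⊢
    rw [← e, smul_sub]
    abel
  have hx : x - u = 0 := by
    rw [hv, inner_smul_right, Complex.re_ofReal_mul] at hre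
    have h4 : (⟪x - u, x - u⟫_ℂ).re = ‖x - u‖ ^ 2 := (norm_sq_eq_re_inner (𝕜 := ℂ) _).symm
    have : ‖x - u‖ ^ 2 ≤ 0 := by
      by_contra hc
      nlinarith [mul_pos hl (not_le.1 hc)]
    exact norm_eq_zero.1 (pow_eq_zero_iff two_ne_zero |>.1 (le_antisymm this (sq_nonneg _)))
  rw [hx, smul_zero] at hv
  rwa [sub_eq_zero.1 hx, sub_eq_zero.1 hv]

/-- The limit of the Yosida approximations. -/
theorem exists_semigroup_of_isResolvent [CompleteSpace X] {A : X →ₗ.[ℂ] X}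
    (hA : IsDissipative A.graph) (hD : Dense {x | ∃ y, (x, y) ∈ A.graph})
    {l : ℕ → ℝ} {J : ℕ → X →L[ℂ] X} (hl : Tendsto (fun n => (l n)⁻¹) atTop (𝓝 0))
    (hJ : ∀ n, IsResolvent A.graph (l n) (J n)) :
    ∃ T : ℝ≥0 → X →L[ℂ] X, IsC0Semigroup T ∧ (∀ t x, ‖T t x‖ ≤ ‖x‖) ∧
      ∀ x y, (x, y) ∈ A.graph → ∀ t, 0 ≤ t →
        T t.toNNReal x - x = ∫ s in (0 : ℝ)..t, T s.toNNReal y := by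
  -- On the domain `l (J z - z) = J y` is bounded, so `J z - z` is of order `l⁻¹`; density and
  -- contractivity extend the limit.
  have hJ1 : ∀ z, Tendsto (fun n => J n z) atTop (𝓝 z) := by
    intro z
    have := tendsto_zero_of_dense (L := atTop) (F := fun n => J n - 1) (C := 2)
      (fun n z => ?_) hD (fun z hz => ?_) z
    · have := this.add_const z
      simpa using this
    · change ‖J n z - z‖ ≤ _
      exact (norm_sub_le _ _).trans (by linarith [(hJ n).norm_le z])
    · obtain ⟨y, hy⟩ := hz
      refine squeeze_zero_norm (a := fun n => (l n)⁻¹ * ‖y‖) (fun n => ?_) (by simpa using hl.mul_const ‖y‖)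
      have h1 := (hJ n).yosida_eq hy
      have hp := (hJ n).pos
      have h2 := (hJ n).norm_le y
      rw [← h1, yosida_apply, norm_smul, Complex.norm_real, Real.norm_of_nonneg hp.le] at h2
      change ‖J n z - z‖ ≤ _
      rwa [inv_mul_eq_div, le_div_iff₀' hp]
  have hcauchy : ∀ (t : ℝ≥0) (z : X), CauchySeq fun n => yosidaExp (l n) (J n) t z := by
    intro t z
    have := tendsto_zero_of_dense (L := atTop) (C := 2)
      (F := fun p : ℕ × ℕ => yosidaExp (l p.1) (J p.1) t - yosidaExp (l p.2) (J p.2) t)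
      (fun p z => ?_) hD (fun z hz => ?_) z
    · rw [cauchySeq_iff_tendsto_dist_atTop_0]
      simpa [dist_eq_norm] using this.norm
    · change ‖yosidaExp (l p.1) (J p.1) t z - yosidaExp (l p.2) (J p.2) t z‖ ≤ _
      refine (norm_sub_le _ _).trans ?_
      linarith [(hJ p.1).norm_yosidaExp_le t.coe_nonneg z, (hJ p.2).norm_yosidaExp_le t.coe_nonneg z]
    · obtain ⟨y, hy⟩ := hz
      have h1 : Tendsto (fun p : ℕ × ℕ => 4 * ‖y‖ ^ 2 * ((l p.1)⁻¹ + (l p.2)⁻¹) * (t : ℝ)) atTop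
          (𝓝 0) := by
        rw [← prod_atTop_atTop_eq]
        have := ((hl.comp tendsto_fst).add (hl.comp tendsto_snd)).const_mul (4 * ‖y‖ ^ 2)
          |>.mul_const (t : ℝ)
        simpa using this
      have h2 := squeeze_zero (fun p => sq_nonneg _) (fun p : ℕ × ℕ =>
        (hJ p.1).norm_yosidaExp_sub_sq_le hA (hJ p.2) t.coe_nonneg hy) h1
      rw [tendsto_zero_iff_norm_tendsto_zero]
      -- The estimate controls the square of the norm, hence the square root.
      have h3 := (Real.continuous_sqrt.tendsto 0).comp h2
      rw [Real.sqrt_zero] at h3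
      refine h3.congr fun p => ?_
      simp only [Function.comp_apply, Real.sqrt_sq (norm_nonneg _)]
      rfl
  choose f hf using fun t z => cauchySeq_tendsto_of_complete (hcauchy t z)
  let T : ℝ≥0 → X →L[ℂ] X := fun t => continuousLinearMapOfTendsto
    (fun n => yosidaExp (l n) (J n) t) (f := f t) (tendsto_pi_nhds.2 (hf t))
  have hT : ∀ t z, Tendsto (fun n => yosidaExp (l n) (J n) (t : ℝ≥0) z) atTop (𝓝 (T t z)) := hf
  have hTle : ∀ t z, ‖T t z‖ ≤ ‖z‖ := fun t z =>
    le_of_tendsto (hT t z).norm (Eventually.of_forall fun n => (hJ n).norm_yosidaExp_le t.coe_nonneg z)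
  have hT' : ∀ (t : ℝ≥0) (z : ℕ → X) (w : X), Tendsto z atTop (𝓝 w) →
      Tendsto (fun n => yosidaExp (l n) (J n) t (z n)) atTop (𝓝 (T t w)) := by
    intro t z w hz
    have h1 : Tendsto (fun n => yosidaExp (l n) (J n) t (z n - w)) atTop (𝓝 0) := by
      refine squeeze_zero_norm (fun n => (hJ n).norm_yosidaExp_le t.coe_nonneg _) ?_
      simpa using (hz.sub_const w).norm
    simpa using h1.add (hT t w)
  have hTadd : ∀ s t, T (s + t) = T s ∘L T t := fun s t => by
    ext z
    refine tendsto_nhds_unique (hT (s + t) z) ?_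
    simpa [yosidaExp_add] using hT' s _ _ (hT t z)
  -- For each approximation this is the fundamental theorem of calculus with integrand `exp (s A_n)
  -- (J_n y)`, where `A_n` is the Yosida approximation. The integrands are dominated by `‖y‖` and
  -- converge pointwise.
  have hint : ∀ x y, (x, y) ∈ A.graph → ∀ t, 0 ≤ t →
      T t.toNNReal x - x = ∫ s in (0 : ℝ)..t, T s.toNNReal y := by
    intro x y hxy t ht
    have hcont : ∀ n, Continuous fun s => yosidaExp (l n) (J n) s (J n y) := fun n =>
      continuous_iff_continuousAt.2 fun s => (hasDerivAt_yosidaExp _ _ s _).continuousAt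
    have h1 : ∀ n, ∫ s in (0 : ℝ)..t, yosidaExp (l n) (J n) s (J n y) =
        yosidaExp (l n) (J n) t x - x := fun n => by
      rw [intervalIntegral.integral_eq_sub_of_hasDerivAt
        (f := fun s => yosidaExp (l n) (J n) s x) (fun s _ => ?_)
        ((hcont n).intervalIntegrable _ _), yosidaExp_zero]
      · rfl
      · rw [← (hJ n).yosida_eq hxy, ← yosidaExp_comm]
        exact hasDerivAt_yosidaExp _ _ s x
    have h2 : Tendsto (fun n => ∫ s in (0 : ℝ)..t, yosidaExp (l n) (J n) s (J n y)) atTop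
        (𝓝 (∫ s in (0 : ℝ)..t, T s.toNNReal y)) := by
      refine intervalIntegral.tendsto_integral_filter_of_dominated_convergence (fun _ => ‖y‖)
        (Eventually.of_forall fun n => (hcont n).aestronglyMeasurable) ?_
        intervalIntegrable_const ?_
      · refine Eventually.of_forall fun n => ae_of_all _ fun s hs => ?_
        rw [uIoc_of_le ht] at hs
        exact ((hJ n).norm_yosidaExp_le hs.1.le _).trans ((hJ n).norm_le y)
      · refine ae_of_all _ fun s hs => ?_
        rw [uIoc_of_le ht] at hs
        have := hT' s.toNNReal _ _ (hJ1 y)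
        rwa [Real.coe_toNNReal _ hs.1.le] at this
    simp only [h1] at h2
    have h3 := (hT t.toNNReal x).sub_const x
    rw [Real.coe_toNNReal _ ht] at h3
    exact tendsto_nhds_unique h3 h2
  refine ⟨T, ⟨?_, hTadd, fun x => ?_⟩, hTle, hint⟩
  · ext z
    refine tendsto_nhds_unique (hT 0 z) ?_
    simp [yosidaExp_zero]
  · have := tendsto_zero_of_dense (L := 𝓝[>] (0 : ℝ≥0)) (F := fun h => T h - 1) (C := 2)
      (fun n z => ?_) hD (fun z hz => ?_) x
    · simpa using this.add_const x
    · change ‖T n z - z‖ ≤ _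
      exact (norm_sub_le _ _).trans (by linarith [hTle n z])
    · obtain ⟨y, hy⟩ := hz
      have h0 : Tendsto (fun h : ℝ≥0 => ‖y‖ * (h : ℝ)) (𝓝[>] 0) (𝓝 0) := by
        have : Continuous fun h : ℝ≥0 => ‖y‖ * (h : ℝ) := by fun_prop
        simpa using (this.tendsto 0).mono_left nhdsWithin_le_nhds
      refine squeeze_zero_norm (fun h => ?_) h0
      change ‖T h z - z‖ ≤ _
      have h1 := hint z y hy h h.coe_nonneg
      rw [Real.toNNReal_coe] at h1
      rw [h1]
      have := intervalIntegral.norm_integral_le_of_norm_le_const (a := (0 : ℝ)) (b := h)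
        (f := fun s : ℝ => T s.toNNReal y) (fun s _ => hTle _ y)
      simpa using this

/-- A dissipative operator on a Hilbert space, such that `l - A` is onto for all large `l`,
generates a semigroup of contractions. -/
theorem IsDissipative.exists_semigroup [CompleteSpace X] {A : X →ₗ.[ℂ] X}
    (hA : IsDissipative A.graph) {l₀ : ℝ} (hl₀ : 0 < l₀)
    (hR : ∀ l : ℝ, l₀ ≤ l → ∀ z, ∃ x y, (x, y) ∈ A.graph ∧ (l : ℂ) • x - y = z) :
    ∃ T : ℝ≥0 → X →L[ℂ] X, IsC0Semigroup T ∧ IsGenerator T A ∧ (∀ t x, ‖T t x‖ ≤ ‖x‖) ∧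
      ∀ x y, (x, y) ∈ A.graph → ∀ t, 0 ≤ t →
        T t.toNNReal x - x = ∫ s in (0 : ℝ)..t, T s.toNNReal y := by
  have hpos : ∀ n : ℕ, 0 < l₀ + n := fun n => by positivity
  have hres : ∀ n : ℕ, ∃ J, IsResolvent A.graph (l₀ + n) J := fun n => by
    obtain ⟨J, h1, h2, h3⟩ := hA.exists_resolvent (hpos n) (hR _ (by simp))
    exact ⟨J, hpos n, h1, h2, h3⟩
  choose J hJ using hres
  obtain ⟨T, hT, hTle, hint⟩ := exists_semigroup_of_isResolvent hA
    (hA.dense_domain hl₀ (hR l₀ le_rfl)) (l := fun n : ℕ => l₀ + n)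
    (tendsto_inv_atTop_zero.comp (tendsto_atTop_add_const_left _ _ tendsto_natCast_atTop_atTop))
    hJ
  refine ⟨T, hT, IsGenerator.of_le hTle hl₀ (hR l₀ le_rfl) fun x y hxy => ?_, hTle, hint⟩
  -- By the integral identity, the quotient `(T(h) x - x) / h` is an average of `T(s) y` over `[0,
  -- h]`, with limit `y`.
  have hd := (hT.continuous_toNNReal hTle y).integral_hasStrictDerivAt 0 0 |>.hasDerivAt
  rw [hasDerivAt_iff_tendsto_slope_zero] at hd
  have hc : Tendsto (fun h : ℝ≥0 => (h : ℝ)) (𝓝[>] 0) (𝓝[≠] 0) := by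
    refine tendsto_nhdsWithin_iff.2 ⟨?_, ?_⟩
    · exact (NNReal.continuous_coe.tendsto' 0 0 rfl).mono_left nhdsWithin_le_nhds
    · filter_upwards [self_mem_nhdsWithin] with h hh
      exact NNReal.coe_ne_zero.2 (ne_of_gt hh)
  have := hd.comp hc
  rw [Real.toNNReal_zero, hT.apply_zero] at this
  refine this.congr fun h => ?_
  have h1 := hint x y hxy h h.coe_nonneg
  rw [Real.toNNReal_coe] at h1
  simp [h1]

end HilleYosida

/-! ### The abstract Cauchy problem -/

section Cauchy

/-- A linear isometry preserves the size of the remainder. This lets derivatives in `D(A^n)` be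
computed in the surrounding product space. -/
theorem hasDerivWithinAt_of_norm_map {E F : Type*} [NormedAddCommGroup E]
    [NormedSpace ℝ E] [NormedAddCommGroup F] [NormedSpace ℝ F] (L : E →ₗ[ℝ] F) (hL : ∀ x, ‖L x‖ = ‖x‖)
    {f : ℝ → E} {f' : E}
    {s : Set ℝ} {x : ℝ} (h : HasDerivWithinAt (fun t => L (f t)) (L f') s x) :
    HasDerivWithinAt f f' s x := by
  rw [hasDerivWithinAt_iff_isLittleO] at h ⊢
  rw [← Asymptotics.isLittleO_norm_left] at h ⊢
  refine h.congr_left fun t => ?_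
  rw [← map_smul, ← map_sub, ← map_sub, hL]

variable {X : Type*} [NormedAddCommGroup X]

/-! ### Orbits of the semigroup in the domains of powers. -/

section Orbit

variable [NormedSpace ℂ X] {A : X →ₗ.[ℂ] X} {T : ℝ≥0 → X →L[ℂ] X}

theorem GraphPow.toX_injective (n : ℕ) :
    Function.Injective (GraphPow.toX : GraphPow A n → X) := by
  intro v w h
  apply Subtype.ext
  ext1 i
  induction i using Fin.induction with
  | zero => exact h
  | succ i ih =>
    have h1 := v.2 i
    rw [ih] at h1
    exact A.mem_graph_snd_inj h1 (w.2 i) rfl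

/-- The inclusion `D(A^n) ⊆ D(A^m)` for `m ≤ n`. -/
def GraphPow.restrict {m n : ℕ} (h : m ≤ n) (w : GraphPow A n) : GraphPow A m :=
  ⟨WithLp.toLp 2 fun i => w.1 (Fin.castLE (Nat.succ_le_succ h) i), fun i => w.2 (Fin.castLE h i)⟩

/-- The map `A : D(A^(n+1)) → D(A^n)`. -/
def GraphPow.tail {n : ℕ} (w : GraphPow A (n + 1)) : GraphPow A n :=
  ⟨WithLp.toLp 2 fun i => w.1 i.succ, fun i => w.2 i.succ⟩

/-- `T t` is continuous and commutes with the difference quotients that define the generator. -/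
theorem IsGenerator.map_mem (hT : IsC0Semigroup T) (hgen : IsGenerator T A) (t : ℝ≥0) {x y : X}
    (h : (x, y) ∈ A.graph) : (T t x, T t y) ∈ A.graph := by
  rw [hgen] at h ⊢
  refine (((T t).continuous.tendsto y).comp h).congr fun h => ?_
  simp only [Function.comp_apply]
  rw [← hT.apply_add, add_comm, hT.apply_add, ← Complex.coe_smul, ← Complex.coe_smul, map_smul,
    map_sub]

/-- The orbit `t ↦ T(t) w` in `D(A^n)`. -/
def GraphPow.orbit (hT : IsC0Semigroup T) (hgen : IsGenerator T A) {n : ℕ} (w : GraphPow A n)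
    (t : ℝ) : GraphPow A n :=
  ⟨WithLp.toLp 2 fun i => T t.toNNReal (w.1 i), fun i => hgen.map_mem hT _ (w.2 i)⟩

theorem GraphPow.continuous_orbit (hT : IsC0Semigroup T) (hgen : IsGenerator T A)
    (hTle : ∀ t x, ‖T t x‖ ≤ ‖x‖) {n : ℕ} (w : GraphPow A n) : Continuous (GraphPow.orbit hT hgen w) :=
  Continuous.subtype_mk ((PiLp.continuous_toLp 2 _).comp
    (continuous_pi fun i => hT.continuous_toNNReal hTle (w.1 i))) _

variable [CompleteSpace X]

theorem IsC0Semigroup.hasDerivWithinAt (hT : IsC0Semigroup T) (hTle : ∀ t x, ‖T t x‖ ≤ ‖x‖)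
    (hint : ∀ x y, (x, y) ∈ A.graph → ∀ t, 0 ≤ t →
      T t.toNNReal x - x = ∫ s in (0 : ℝ)..t, T s.toNNReal y)
    {x y : X} (h : (x, y) ∈ A.graph) {t : ℝ} (ht : 0 ≤ t) :
    HasDerivWithinAt (fun t : ℝ => T t.toNNReal x) (T t.toNNReal y) (Ici 0) t := by
  have hd := ((hT.continuous_toNNReal hTle y).integral_hasStrictDerivAt 0 t).hasDerivAt
  refine ((hd.const_add x).hasDerivWithinAt (s := Ici 0)).congr (fun s hs => ?_) ?_
  · rw [← hint x y h s hs]; abel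
  · rw [← hint x y h t ht]; abel

theorem GraphPow.hasDerivWithinAt_orbit (hT : IsC0Semigroup T) (hgen : IsGenerator T A)
    (hTle : ∀ t x, ‖T t x‖ ≤ ‖x‖) (hint : ∀ x y, (x, y) ∈ A.graph → ∀ t, 0 ≤ t →
      T t.toNNReal x - x = ∫ s in (0 : ℝ)..t, T s.toNNReal y)
    {n : ℕ} (w : GraphPow A (n + 1)) {t : ℝ} (ht : 0 ≤ t) :
    HasDerivWithinAt (GraphPow.orbit hT hgen (GraphPow.restrict n.le_succ w))
      (GraphPow.orbit hT hgen (GraphPow.tail w) t) (Ici 0) t := by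
  apply hasDerivWithinAt_of_norm_map ((GraphPow A n).subtype.restrictScalars ℝ) fun _ => rfl
  have h : HasDerivWithinAt (fun (t : ℝ) (i : Fin (n + 1)) => T t.toNNReal (w.1 i.castSucc))
      (fun i => T t.toNNReal (w.1 i.succ)) (Ici 0) t :=
    hasDerivWithinAt_pi.2 fun i => hT.hasDerivWithinAt hTle hint (w.2 i) ht
  exact ((PiLp.continuousLinearEquiv 2 ℝ fun _ : Fin (n + 1) => X).symm.hasFDerivAt
    (x := fun i => T t.toNNReal (w.1 i.castSucc))).comp_hasDerivWithinAt t h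

/-- The derivative of the orbit of `w` is the orbit of `A w`, whose starting point has lost one
power of the domain; induction on `k` uses up the `k` spare powers. -/
theorem GraphPow.contDiffOn_orbit (hT : IsC0Semigroup T) (hgen : IsGenerator T A)
    (hTle : ∀ t x, ‖T t x‖ ≤ ‖x‖) (hint : ∀ x y, (x, y) ∈ A.graph → ∀ t, 0 ≤ t →
      T t.toNNReal x - x = ∫ s in (0 : ℝ)..t, T s.toNNReal y)
    (k : ℕ) {l : ℕ} (w : GraphPow A l) (hw : GraphPow.toX w ∈ domPow A (l + k)) :
    ContDiffOn ℝ k (GraphPow.orbit hT hgen w) (Ici 0) := by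
  induction k generalizing w with
  | zero => exact contDiffOn_zero.2 (GraphPow.continuous_orbit hT hgen hTle w).continuousOn
  | succ k ih =>
    obtain ⟨w', hw'⟩ := hw
    let u : GraphPow A (l + 1) := GraphPow.restrict (by omega) w'
    have hu : w = GraphPow.restrict l.le_succ u := GraphPow.toX_injective l hw'.symm
    have hd : ∀ t ∈ Ici (0 : ℝ), HasDerivWithinAt (GraphPow.orbit hT hgen w)
        (GraphPow.orbit hT hgen (GraphPow.tail u) t) (Ici 0) t := fun t ht => by
      rw [hu]; exact GraphPow.hasDerivWithinAt_orbit hT hgen hTle hint u ht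
    have hk := ih (GraphPow.tail u) ⟨GraphPow.tail (n := l + k) w', rfl⟩
    push_cast
    rw [contDiffOn_succ_iff_derivWithin (uniqueDiffOn_Ici 0)]
    refine ⟨fun t ht => (hd t ht).differentiableWithinAt, by simp, hk.congr fun t ht => ?_⟩
    exact (hd t ht).derivWithin (uniqueDiffOn_Ici 0 t ht)

/-- Applying `T(h) - 1` to the integral over `[0, t]` telescopes to the integral over `[t, t + h]`
minus that over `[0, h]`. Divided by `h`, this tends to `T(t) x - x`. -/
theorem IsGenerator.isMildSolution (hT : IsC0Semigroup T) (hgen : IsGenerator T A)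
    (hTle : ∀ t x, ‖T t x‖ ≤ ‖x‖) (x : X) :
    IsMildSolution A x fun t : ℝ => T t.toNNReal x := by
  have hc := hT.continuous_toNNReal hTle x
  refine ⟨hc.continuousOn, fun t ht => ?_⟩
  set S : ℝ → X := fun t => T t.toNNReal x
  have hcoe : Tendsto (fun h : ℝ≥0 => (h : ℝ)) (𝓝[>] 0) (𝓝[≠] 0) := by
    refine tendsto_nhdsWithin_iff.2 ⟨?_, ?_⟩
    · exact (NNReal.continuous_coe.tendsto' 0 0 rfl).mono_left nhdsWithin_le_nhds
    · filter_upwards [self_mem_nhdsWithin] with h hh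
      exact NNReal.coe_ne_zero.2 (ne_of_gt hh)
  have hslope : ∀ r, Tendsto (fun h : ℝ≥0 => (h : ℝ)⁻¹ • ((∫ s in (0 : ℝ)..(r + h), S s) -
      ∫ s in (0 : ℝ)..r, S s)) (𝓝[>] 0) (𝓝 (S r)) := fun r =>
    (hasDerivAt_iff_tendsto_slope_zero.1 (hc.integral_hasStrictDerivAt 0 r).hasDerivAt).comp hcoe
  rw [hgen]
  have h0 : S 0 = x := by simp [S, hT.apply_zero]
  have := (hslope t).sub (hslope 0)
  rw [h0] at this
  refine this.congr fun h => ?_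
  rw [← smul_sub, zero_add, intervalIntegral.integral_same, sub_zero]
  congr 1
  have h1 : T h (∫ s in (0 : ℝ)..t, S s) = ∫ s in (0 : ℝ)..t, S (s + h) := by
    rw [← (T h).intervalIntegral_comp_comm (hc.intervalIntegrable _ _)]
    refine intervalIntegral.integral_congr fun s hs => ?_
    rw [uIcc_of_le ht] at hs
    simp only [S]
    rw [← hT.apply_add, Real.toNNReal_add hs.1 h.coe_nonneg, Real.toNNReal_coe, add_comm]
  rw [h1, intervalIntegral.integral_comp_add_right, zero_add,
    ← intervalIntegral.integral_interval_sub_left (hc.intervalIntegrable 0 (t + h))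
      (hc.intervalIntegrable (μ := volume) 0 h)]
  abel

end Orbit

/-! ### Uniqueness of solutions by dissipativity. -/

variable [InnerProductSpace ℂ X]

theorem IsDissipative.eq_zero {A : X →ₗ.[ℂ] X} (hA : IsDissipative A.graph) {u u' : ℝ → X}
    (hu : ∀ t, 0 ≤ t → HasDerivWithinAt u (u' t) (Ici 0) t)
    (h : ∀ t, 0 ≤ t → (u t, u' t) ∈ A.graph) (h0 : u 0 = 0) {t : ℝ} (ht : 0 ≤ t) : u t = 0 := by
  have := norm_le_of_re_inner_nonpos hu (fun t ht => hA _ _ (h t ht)) ht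
  rw [h0, norm_zero] at this
  exact norm_le_zero_iff.1 this

theorem IsDissipative.eqOn_of_isClassicalSolution {A : X →ₗ.[ℂ] X} (hA : IsDissipative A.graph)
    {x : X} {U V : ℝ → X} (hU : IsClassicalSolution A x U) (hV : IsClassicalSolution A x V) :
    EqOn V U (Ici 0) := by
  have h : ∀ t, ∃ W, 0 ≤ t → (V t - U t, W) ∈ A.graph ∧
      HasDerivWithinAt (fun t => V t - U t) W (Ici 0) t := by
    intro t
    by_cases ht : 0 ≤ t
    · obtain ⟨w, h1, h2⟩ := hU.deriv t ht
      obtain ⟨v, h3, h4⟩ := hV.deriv t ht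
      exact ⟨v - w, fun _ => ⟨A.graph.sub_mem h3 h1, h4.sub h2⟩⟩
    -- A default value at negative times, so that `choose` yields a total function.
    · exact ⟨0, fun h => absurd h ht⟩
  choose W hW using h
  intro t ht
  have := hA.eq_zero (u := fun t => V t - U t) (fun t ht => (hW t ht).2) (fun t ht => (hW t ht).1)
    (by simp [hU.initial, hV.initial]) (mem_Ici.1 ht)
  exact sub_eq_zero.1 this

/-- The primitive of the difference is a classical solution with zero initial value, so it vanishes,
and so does its derivative. -/
theorem IsDissipative.eqOn_of_isMildSolution [CompleteSpace X] {A : X →ₗ.[ℂ] X}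
    (hA : IsDissipative A.graph) {x : X} {U V : ℝ → X} (hU : IsMildSolution A x U)
    (hV : IsMildSolution A x V) : EqOn V U (Ici 0) := by
  -- Extended by its value at `0`, the difference is continuous on the whole line, so its primitive
  -- is differentiable also at the endpoint.
  set w : ℝ → X := fun t => V (max t 0) - U (max t 0) with hw
  have hmax : ∀ t : ℝ, max t 0 ∈ Ici (0 : ℝ) := fun t => mem_Ici.2 (le_max_right _ _)
  have hwc : Continuous w :=
    (hV.continuousOn.comp_continuous (by fun_prop) hmax).sub
      (hU.continuousOn.comp_continuous (by fun_prop) hmax)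
  have hwe : ∀ t, 0 ≤ t → w t = V t - U t := fun t ht => by simp [hw, max_eq_left ht]
  have hd : ∀ t, 0 ≤ t → HasDerivWithinAt (fun t => ∫ s in (0 : ℝ)..t, w s) (w t) (Ici 0) t :=
    fun t _ => (hwc.integral_hasStrictDerivAt 0 t).hasDerivAt.hasDerivWithinAt
  have hz : ∀ t, 0 ≤ t → ∫ s in (0 : ℝ)..t, w s = 0 := fun t ht => by
    refine hA.eq_zero hd (fun t ht => ?_) (by simp) ht
    have hi : ∀ {F : ℝ → X}, ContinuousOn F (Ici 0) → IntervalIntegrable F volume 0 t :=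
      fun hF => (hF.mono (by rw [uIcc_of_le ht]; exact Icc_subset_Ici_self)).intervalIntegrable
    have h1 := A.graph.sub_mem (hV.integrated t ht) (hU.integrated t ht)
    rw [Prod.mk_sub_mk, ← intervalIntegral.integral_sub (hi hV.continuousOn) (hi hU.continuousOn),
      sub_sub_sub_cancel_right, ← hwe t ht] at h1
    rwa [intervalIntegral.integral_congr fun s hs => ?_]
    rw [uIcc_of_le ht] at hs
    exact hwe s hs.1
  intro t ht
  have h1 : HasDerivWithinAt (fun t => ∫ s in (0 : ℝ)..t, w s) 0 (Ici 0) t :=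
    (hasDerivWithinAt_const t _ (0 : X)).congr (fun s hs => hz s hs) (hz t ht)
  have h2 := (uniqueDiffOn_Ici (0 : ℝ) t ht).eq_deriv _ (hd t ht) h1
  rw [hwe t ht] at h2
  exact sub_eq_zero.1 h2

/-- Well-posedness of the Cauchy problem in the domains of the powers of the generator. -/
theorem IsDissipative.exists_unique_solution [CompleteSpace X] {A : X →ₗ.[ℂ] X}
    (hA : IsDissipative A.graph) {T : ℝ≥0 → X →L[ℂ] X} (hT : IsC0Semigroup T)
    (hgen : IsGenerator T A) (hTle : ∀ t x, ‖T t x‖ ≤ ‖x‖)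
    (hint : ∀ x y, (x, y) ∈ A.graph → ∀ t, 0 ≤ t →
      T t.toNNReal x - x = ∫ s in (0 : ℝ)..t, T s.toNNReal y)
    (n : ℕ) (U₀ : X) (hU₀ : U₀ ∈ domPow A n) :
    ∃ U : ℝ → X, (InSmoothClass A n U ∧ IsSolution A n U₀ U) ∧
      ∀ V : ℝ → X, InSmoothClass A n V → IsSolution A n U₀ V → EqOn V U (Ici 0) := by
  have hsol : IsSolution A n U₀ fun t : ℝ => T t.toNNReal U₀ := by
    match n, hU₀ with
    | 0, _ => exact hgen.isMildSolution hT hTle U₀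
    | n + 1, ⟨w, hw⟩ =>
      have h01 : (U₀, w.1 (Fin.succ 0)) ∈ A.graph := by rw [← hw]; exact w.2 0
      exact ⟨by simp [hT.apply_zero], fun t ht => ⟨_, hgen.map_mem hT _ h01,
        hT.hasDerivWithinAt hTle hint h01 ht⟩⟩
  refine ⟨fun t => T t.toNNReal U₀, ⟨?_, hsol⟩, fun V _ hV => ?_⟩
  · intro k l hkl
    obtain ⟨w, hw⟩ := hU₀
    refine ⟨GraphPow.orbit hT hgen (GraphPow.restrict (by omega : l ≤ n) w),
      GraphPow.contDiffOn_orbit hT hgen hTle hint k _ ?_, fun t _ => ?_⟩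
    · obtain rfl : n = l + k := by omega
      exact ⟨w, rfl⟩
    · change T t.toNNReal (w.1 0) = _
      rw [← hw]; rfl
  · match n, hsol, hV with
    | 0, hU, hV => exact hA.eqOn_of_isMildSolution hU hV
    | n + 1, hU, hV => exact hA.eqOn_of_isClassicalSolution hU hV

end Cauchy

/-! ### The memory kernel is nonincreasing -/

namespace MemoryKernel

/-- The derivative of `g` is `-f'' ≤ 0`. -/
theorem antitoneOn_g (K : MemoryKernel) : AntitoneOn K.g (Ici 0) := by
  have h2 : ContDiffOn ℝ 1 (derivWithin K.f (Ici 0)) (Ici 0) := by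
    have := K.contDiffOn
    rw [show (2 : WithTop ℕ∞) = 1 + 1 by norm_num,
      contDiffOn_succ_iff_derivWithin (uniqueDiffOn_Ici 0)] at this
    exact this.2.2
  obtain ⟨c, -, hc⟩ := K.deriv_two
  refine MonotoneOn.neg ?_
  refine monotoneOn_of_deriv_nonneg (convex_Ici 0) h2.continuousOn
    ((h2.differentiableOn one_ne_zero).mono interior_subset) fun x hx => ?_
  rw [interior_Ici] at hx
  have h3 := (hc x (mem_Ici.2 (le_of_lt hx))).1
  rw [iteratedDerivWithin_succ, iteratedDerivWithin_one,
    derivWithin_of_mem_nhds (Ici_mem_nhds hx)] at h3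
  exact h3

theorem restrict_absolutelyContinuous_weight (K : MemoryKernel) :
    volume.restrict (Ioi (0 : ℝ)) ≪ K.weight :=
  Measure.ae_le_iff_absolutelyContinuous.1 fun _ hs => K.ae_weight_iff.1 hs

theorem weight_absolutelyContinuous_restrict (K : MemoryKernel) :
    K.weight ≪ volume.restrict (Ioi (0 : ℝ)) :=
  withDensity_absolutelyContinuous _ _

theorem lintegral_weight (K : MemoryKernel) {F : ℝ → ℝ≥0∞}
    (hF : AEMeasurable F (volume.restrict (Ioi (0 : ℝ)))) :
    ∫⁻ s, F s ∂K.weight = ∫⁻ s in Ioi (0 : ℝ), ENNReal.ofReal (K.g s) * F s := by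
  rw [weight, lintegral_withDensity_eq_lintegral_mul₀ K.aemeasurable_g.ennreal_ofReal hF]
  rfl

theorem integral_weight (K : MemoryKernel) (F : ℝ → ℂ) :
    ∫ s, F s ∂K.weight = ∫ s in Ioi (0 : ℝ), (K.g s : ℂ) * F s := by
  rw [weight, integral_withDensity_eq_integral_toReal_smul₀ K.aemeasurable_g.ennreal_ofReal
    (by simp)]
  refine integral_congr_ae ?_
  filter_upwards [ae_restrict_mem measurableSet_Ioi] with s hs
  rw [ENNReal.toReal_ofReal (K.g_pos (le_of_lt hs)).le, Complex.real_smul]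

variable {V : Type*} [NormedAddCommGroup V]

/-- On `(0, s]` the weight is bounded below by `g(s) > 0`, so weighted integrability implies local
integrability up to `0`. This gives a meaning to primitives of elements of `L_j`. -/
theorem intervalIntegrable_of_integrable (K : MemoryKernel) {F : ℝ → V}
    (hF : Integrable F K.weight) {s : ℝ} (hs : 0 ≤ s) : IntervalIntegrable F volume 0 s := by
  rw [intervalIntegrable_iff_integrableOn_Ioc_of_le hs]
  have hsub : volume.restrict (Ioc 0 s) ≤ volume.restrict (Ioi (0 : ℝ)) :=
    Measure.restrict_mono Ioc_subset_Ioi_self le_rfl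
  refine ⟨(hF.1.mono_ac K.restrict_absolutelyContinuous_weight).mono_measure hsub, ?_⟩
  have h1 := hF.2
  have hm : AEMeasurable (fun s => ‖F s‖ₑ) (volume.restrict (Ioi (0 : ℝ))) :=
    (hF.1.mono_ac K.restrict_absolutelyContinuous_weight).enorm
  rw [hasFiniteIntegral_iff_enorm, K.lintegral_weight hm] at h1
  have hpos : 0 < ENNReal.ofReal (K.g s) := ENNReal.ofReal_pos.2 (K.g_pos hs)
  have h2 : ENNReal.ofReal (K.g s) * ∫⁻ τ in Ioc 0 s, ‖F τ‖ₑ < ⊤ := by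
    rw [← lintegral_const_mul' _ _ ENNReal.ofReal_ne_top]
    refine lt_of_le_of_lt ?_ h1
    refine le_trans ?_ (lintegral_mono' hsub le_rfl)
    refine setLIntegral_mono' measurableSet_Ioc fun τ hτ => ?_
    gcongr
    exact K.antitoneOn_g (mem_Ici.2 hτ.1.le) (mem_Ici.2 hs) hτ.2
  rw [hasFiniteIntegral_iff_enorm]
  exact (ENNReal.mul_lt_top_iff.1 h2).elim (fun h => h.2)
    (fun h => h.elim (fun h => absurd h hpos.ne') (fun h => by rw [h]; exact ENNReal.zero_lt_top))

theorem intervalIntegrable_lp (K : MemoryKernel) (ζ : Lp V 2 K.weight) {s : ℝ} (hs : 0 ≤ s) :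
    IntervalIntegrable ζ volume 0 s :=
  K.intervalIntegrable_of_integrable ((Lp.memLp ζ).integrable (by norm_num)) hs

end MemoryKernel

/-! ### Primitives -/

section Primitive

variable {V : Type*} [NormedAddCommGroup V] [NormedSpace ℝ V]

theorem continuousOn_primitive_Ici {ζ : ℝ → V}
    (hζ : ∀ s, 0 ≤ s → IntervalIntegrable ζ volume 0 s) :
    ContinuousOn (fun s => ∫ τ in (0 : ℝ)..s, ζ τ) (Ici 0) := by
  intro s hs
  have hs' : (0 : ℝ) ≤ s + 1 := by linarith [mem_Ici.1 hs]
  have hc := intervalIntegral.continuousOn_primitive_interval' (hζ (s + 1) hs') left_mem_uIcc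
  rw [uIcc_of_le hs'] at hc
  refine (hc s ⟨hs, by linarith⟩).mono_of_mem_nhdsWithin ?_
  rw [← Ici_inter_Iic]
  exact inter_mem self_mem_nhdsWithin (mem_nhdsWithin_of_mem_nhds (Iic_mem_nhds (lt_add_one s)))

variable [CompleteSpace V]

/-- Integration by parts for a merely integrable `ζ`: Fubini for `φ'(τ) ζ(r)` on the triangle `r ≤ τ
≤ s`, without differentiating the primitive. -/
theorem smul_primitive_eq {φ φ' : ℝ → ℝ} (hφ : ∀ x, HasDerivAt φ (φ' x) x) (hφ' : Continuous φ')
    {ζ : ℝ → V} {s : ℝ} (hs : 0 ≤ s) (hζ : IntervalIntegrable ζ volume 0 s) :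
    φ s • ∫ τ in (0 : ℝ)..s, ζ τ =
      ∫ τ in (0 : ℝ)..s, (φ' τ • (∫ r in (0 : ℝ)..τ, ζ r) + φ τ • ζ τ) := by
  have hφc : Continuous φ := continuous_iff_continuousAt.2 fun x => (hφ x).continuousAt
  have hint : IntegrableOn (fun p : ℝ × ℝ => φ' p.1 • ζ p.2) (uIoc 0 s ×ˢ uIoc 0 s) := by
    rw [IntegrableOn, Measure.volume_eq_prod, ← Measure.prod_restrict]
    refine Integrable.smul_prod ?_ ?_
    · exact intervalIntegrable_iff.1 (hφ'.intervalIntegrable 0 s)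
    · exact intervalIntegrable_iff.1 hζ
  have hmeas : MeasurableSet {p : ℝ × ℝ | p.2 ≤ p.1} := measurableSet_le measurable_snd measurable_fst
  have hswap := intervalIntegral_intervalIntegral_swap
    (F := fun τ r => {p : ℝ × ℝ | p.2 ≤ p.1}.indicator (fun p => φ' p.1 • ζ p.2) (τ, r))
    (hint.indicator hmeas)
  have h1 : ∀ τ ∈ uIcc 0 s, ∫ r in (0 : ℝ)..s,
      {p : ℝ × ℝ | p.2 ≤ p.1}.indicator (fun p => φ' p.1 • ζ p.2) (τ, r) =
      φ' τ • ∫ r in (0 : ℝ)..τ, ζ r := by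
    intro τ hτ
    rw [uIcc_of_le hs] at hτ
    rw [← intervalIntegral.integral_smul, intervalIntegral.integral_of_le hs,
      intervalIntegral.integral_of_le hτ.1, ← integral_indicator measurableSet_Ioc,
      ← integral_indicator measurableSet_Ioc]
    congr 1
    ext r
    by_cases hr : r ≤ τ
    · simp [indicator, hr, hr.trans hτ.2]
    · simp [indicator, hr]
  have h2 : ∀ r ∈ uIcc 0 s, ∫ τ in (0 : ℝ)..s,
      {p : ℝ × ℝ | p.2 ≤ p.1}.indicator (fun p => φ' p.1 • ζ p.2) (τ, r) = (φ s - φ r) • ζ r := by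
    intro r hr
    rw [uIcc_of_le hs] at hr
    -- The slice of the triangle at height `r` contains its endpoint `τ = r`; passing to closed
    -- intervals makes the two indicators agree.
    rw [← intervalIntegral.integral_eq_sub_of_hasDerivAt (fun x _ => hφ x)
      (hφ'.intervalIntegrable r s), ← intervalIntegral.integral_smul_const,
      intervalIntegral.integral_of_le hs, intervalIntegral.integral_of_le hr.2,
      ← integral_Icc_eq_integral_Ioc (x := r), ← integral_Icc_eq_integral_Ioc (x := 0),
      ← integral_indicator measurableSet_Icc,
      ← integral_indicator measurableSet_Icc]
    congr 1
    ext τ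
    by_cases h : r ≤ τ
    · simp [indicator, h, hr.1.trans h]
    · simp [indicator, h]
  rw [intervalIntegral.integral_congr h1, intervalIntegral.integral_congr h2] at hswap
  have hζφ : IntervalIntegrable (fun τ => φ τ • ζ τ) volume 0 s :=
    hζ.continuousOn_smul hφc.continuousOn
  have hprim : IntervalIntegrable (fun τ => φ' τ • ∫ r in (0 : ℝ)..τ, ζ r) volume 0 s :=
    (hφ'.continuousOn.smul
      (intervalIntegral.continuousOn_primitive_interval' hζ left_mem_uIcc)).intervalIntegrable
  rw [intervalIntegral.integral_add hprim hζφ, hswap]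
  simp only [sub_smul]
  have hζs : IntervalIntegrable (fun τ => φ s • ζ τ) volume 0 s := hζ.smul (φ s)
  rw [intervalIntegral.integral_sub hζs hζφ, intervalIntegral.integral_smul, sub_add_cancel]

end Primitive

/-! ### Exponential convolutions in the weighted space -/

/-- Cauchy–Schwarz for the measure `P dμ`, with the integrand split as `P^(1/2) · P^(1/2) h`. -/
theorem lintegral_mul_sq_le {α : Type*} [MeasurableSpace α] {μ : Measure α} {P h : α → ℝ≥0∞}
    (hP : AEMeasurable P μ) (hh : AEMeasurable h μ) :
    (∫⁻ a, P a * h a ∂μ) ^ 2 ≤ (∫⁻ a, P a ∂μ) * ∫⁻ a, P a * h a ^ 2 ∂μ := by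
  have h1 := ENNReal.lintegral_mul_le_Lp_mul_Lq μ Real.HolderConjugate.two_two
    (f := fun a => P a ^ (1 / 2 : ℝ)) (g := fun a => P a ^ (1 / 2 : ℝ) * h a)
    (hP.pow_const _) ((hP.pow_const _).mul hh)
  have e1 : ∀ x : ℝ≥0∞, (x ^ (1 / 2 : ℝ)) ^ (2 : ℝ) = x := fun x => by
    rw [← ENNReal.rpow_mul]; norm_num
  have e2 : ∀ x : ℝ≥0∞, x ^ (1 / 2 : ℝ) * x ^ (1 / 2 : ℝ) = x := fun x => by
    rw [← sq, ← ENNReal.rpow_two, e1]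
  simp only [Pi.mul_apply, ENNReal.mul_rpow_of_nonneg _ _ zero_le_two, e1, ← mul_assoc, e2,
    ENNReal.rpow_two] at h1
  refine (pow_le_pow_left' h1 2).trans_eq ?_
  rw [mul_pow, ← ENNReal.rpow_two, ← ENNReal.rpow_two, e1, e1]

theorem setLIntegral_exp_mul_Iic {l : ℝ} (hl : 0 < l) (s : ℝ) :
    ∫⁻ τ in Iic s, ENNReal.ofReal (Real.exp (l * τ)) = ENNReal.ofReal (Real.exp (l * s) / l) := by
  rw [← integral_exp_mul_Iic hl s, ofReal_integral_eq_lintegral_ofReal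
    (integrableOn_exp_mul_Iic hl s) (ae_of_all _ fun _ => (Real.exp_pos _).le)]

theorem setLIntegral_exp_mul_Ici {l : ℝ} (hl : 0 < l) (s : ℝ) :
    ∫⁻ τ in Ici s, ENNReal.ofReal (Real.exp (-l * τ)) =
      ENNReal.ofReal (Real.exp (-l * s) / l) := by
  have h := integral_exp_mul_Ioi (neg_lt_zero.2 hl) s
  rw [neg_div_neg_eq] at h
  rw [setLIntegral_congr Ioi_ae_eq_Ici.symm, ← h, ofReal_integral_eq_lintegral_ofReal
    (integrableOn_exp_mul_Ioi (neg_lt_zero.2 hl) s) (ae_of_all _ fun _ => (Real.exp_pos _).le)]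

/-- A weighted Young inequality. Cauchy–Schwarz against `exp (l τ)`, of mass `exp (l s) / l` on
`(-∞, s]`, gives one factor `l⁻¹`. Since `g(s) ≤ g(τ)` for `τ ≤ s`, the weight can be moved to `τ`;
Tonelli and the integral of `exp (-l (s - τ))` over `s ≥ τ` give the other. -/
theorem MemoryKernel.lintegral_conv_sq_le (K : MemoryKernel) {l : ℝ} (hl : 0 < l) {h : ℝ → ℝ≥0∞}
    (hh : AEMeasurable h (volume.restrict (Ioi (0 : ℝ)))) :
    ∫⁻ s, (ENNReal.ofReal (Real.exp (-l * s)) *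
      ∫⁻ τ in Ioc 0 s, ENNReal.ofReal (Real.exp (l * τ)) * h τ) ^ 2 ∂K.weight ≤
      ENNReal.ofReal l⁻¹ ^ 2 * ∫⁻ s, h s ^ 2 ∂K.weight := by
  set E : ℝ → ℝ≥0∞ := fun s => ENNReal.ofReal (Real.exp (-l * s)) with hE
  set P : ℝ → ℝ≥0∞ := fun s => ENNReal.ofReal (Real.exp (l * s)) with hP
  set γ : ℝ → ℝ≥0∞ := fun s => ENNReal.ofReal (K.g s) with hγ
  set μ := volume.restrict (Ioi (0 : ℝ)) with hμ
  have hEP : ∀ s, E s * P s = 1 := fun s => by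
    simp only [hE, hP]
    rw [← ENNReal.ofReal_mul (Real.exp_pos _).le, ← Real.exp_add]
    simp
  have hEm : Measurable E := by fun_prop
  have hPm : Measurable P := by fun_prop
  have hγm : AEMeasurable γ μ := K.aemeasurable_g.ennreal_ofReal
  -- The inner integral is monotone in `s`, so it is measurable for any `k`.
  have hmono : ∀ k : ℝ → ℝ≥0∞, Measurable fun s => ∫⁻ τ in Ioc 0 s, k τ := fun k =>
    Monotone.measurable fun s t hst =>
      lintegral_mono' (Measure.restrict_mono (Ioc_subset_Ioc_right hst) le_rfl) le_rfl
  have hpt : ∀ s, (E s * ∫⁻ τ in Ioc 0 s, P τ * h τ) ^ 2 ≤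
      ENNReal.ofReal l⁻¹ * (E s * ∫⁻ τ in Ioc 0 s, P τ * h τ ^ 2) := by
    intro s
    have h1 : (∫⁻ τ in Ioc 0 s, P τ * h τ) ^ 2 ≤
        (ENNReal.ofReal l⁻¹ * P s) * ∫⁻ τ in Ioc 0 s, P τ * h τ ^ 2 := by
      refine (lintegral_mul_sq_le hPm.aemeasurable (hh.mono_measure
        (Measure.restrict_mono Ioc_subset_Ioi_self le_rfl))).trans ?_
      gcongr
      refine (lintegral_mono' (Measure.restrict_mono Ioc_subset_Iic_self le_rfl) le_rfl).trans ?_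
      rw [setLIntegral_exp_mul_Iic hl, div_eq_inv_mul, ENNReal.ofReal_mul (inv_nonneg.2 hl.le)]
    calc (E s * ∫⁻ τ in Ioc 0 s, P τ * h τ) ^ 2
        ≤ E s ^ 2 * ((ENNReal.ofReal l⁻¹ * P s) * ∫⁻ τ in Ioc 0 s, P τ * h τ ^ 2) := by
          rw [mul_pow]; gcongr
      _ = (E s * P s) * (ENNReal.ofReal l⁻¹ * (E s * ∫⁻ τ in Ioc 0 s, P τ * h τ ^ 2)) := by ring
      _ = _ := by rw [hEP, one_mul]
  have hmeas : MeasurableSet {p : ℝ × ℝ | p.2 ≤ p.1} :=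
    measurableSet_le measurable_snd measurable_fst
  let F : ℝ → ℝ → ℝ≥0∞ := fun s τ =>
    {p : ℝ × ℝ | p.2 ≤ p.1}.indicator (fun p => E p.1 * (γ p.2 * P p.2 * h p.2 ^ 2)) (s, τ)
  have hF : AEMeasurable (Function.uncurry F) (μ.prod μ) := by
    refine AEMeasurable.indicator ?_ hmeas
    exact (hEm.comp measurable_fst).aemeasurable.mul
      ((hγm.mul hPm.aemeasurable).mul (hh.pow_const 2)).comp_snd
  have hinner : ∀ s ∈ Ioi (0 : ℝ), γ s * (E s * ∫⁻ τ in Ioc 0 s, P τ * h τ ^ 2) ≤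
      ∫⁻ τ, F s τ ∂μ := by
    intro s hs
    rw [← mul_assoc, ← lintegral_const_mul' _ _
      (ENNReal.mul_ne_top ENNReal.ofReal_ne_top ENNReal.ofReal_ne_top),
      ← lintegral_indicator measurableSet_Ioc, hμ, ← lintegral_indicator measurableSet_Ioi]
    refine lintegral_mono fun τ => ?_
    by_cases hτ : τ ∈ Ioc 0 s
    · have h1 : τ ∈ Ioi (0 : ℝ) := hτ.1
      have h2 : F s τ = E s * (γ τ * P τ * h τ ^ 2) :=
        indicator_of_mem (s := {p : ℝ × ℝ | p.2 ≤ p.1}) (a := (s, τ)) hτ.2 _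
      simp only [indicator_of_mem hτ, indicator_of_mem h1, h2]
      have h3 : γ s ≤ γ τ := ENNReal.ofReal_le_ofReal
        (K.antitoneOn_g (mem_Ici.2 hτ.1.le) (mem_Ici.2 (le_of_lt hs)) hτ.2)
      calc γ s * E s * (P τ * h τ ^ 2) ≤ γ τ * E s * (P τ * h τ ^ 2) := by gcongr
        _ = _ := by ring
    · simp [indicator_of_notMem hτ]
  have houter : ∀ τ ∈ Ioi (0 : ℝ), ∫⁻ s, F s τ ∂μ ≤ ENNReal.ofReal l⁻¹ * (γ τ * h τ ^ 2) := by
    intro τ hτ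
    calc ∫⁻ s, F s τ ∂μ ≤ ∫⁻ s, F s τ := lintegral_mono' Measure.restrict_le_self le_rfl
      _ = ∫⁻ s in Ici τ, E s * (γ τ * P τ * h τ ^ 2) := by
        rw [← lintegral_indicator measurableSet_Ici]
        rfl
      _ = ENNReal.ofReal l⁻¹ * (γ τ * h τ ^ 2) := by
        rw [lintegral_mul_const _ hEm, setLIntegral_exp_mul_Ici hl, div_eq_inv_mul,
          ENNReal.ofReal_mul (inv_nonneg.2 hl.le)]
        calc ENNReal.ofReal l⁻¹ * E τ * (γ τ * P τ * h τ ^ 2)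
            = (E τ * P τ) * (ENNReal.ofReal l⁻¹ * (γ τ * h τ ^ 2)) := by ring
          _ = _ := by rw [hEP, one_mul]
  calc ∫⁻ s, (E s * ∫⁻ τ in Ioc 0 s, P τ * h τ) ^ 2 ∂K.weight
      ≤ ∫⁻ s, ENNReal.ofReal l⁻¹ * (E s * ∫⁻ τ in Ioc 0 s, P τ * h τ ^ 2) ∂K.weight :=
        lintegral_mono hpt
    _ = ENNReal.ofReal l⁻¹ * ∫⁻ s, (E s * ∫⁻ τ in Ioc 0 s, P τ * h τ ^ 2) ∂K.weight :=
        lintegral_const_mul' _ _ ENNReal.ofReal_ne_top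
    _ = ENNReal.ofReal l⁻¹ * ∫⁻ s in Ioi (0 : ℝ), γ s * (E s * ∫⁻ τ in Ioc 0 s, P τ * h τ ^ 2) := by
        rw [K.lintegral_weight (F := fun s => E s * ∫⁻ τ in Ioc 0 s, P τ * h τ ^ 2)
          (hEm.mul (hmono _)).aemeasurable]
    _ ≤ ENNReal.ofReal l⁻¹ * ∫⁻ s, ∫⁻ τ, F s τ ∂μ ∂μ := by
        exact mul_le_mul' le_rfl (setLIntegral_mono' measurableSet_Ioi hinner)
    _ = ENNReal.ofReal l⁻¹ * ∫⁻ τ, ∫⁻ s, F s τ ∂μ ∂μ := by rw [lintegral_lintegral_swap hF]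
    _ ≤ ENNReal.ofReal l⁻¹ * ∫⁻ τ in Ioi (0 : ℝ), ENNReal.ofReal l⁻¹ * (γ τ * h τ ^ 2) := by
        exact mul_le_mul' le_rfl (setLIntegral_mono' measurableSet_Ioi houter)
    _ = ENNReal.ofReal l⁻¹ ^ 2 * ∫⁻ s, h s ^ 2 ∂K.weight := by
        rw [lintegral_const_mul' _ _ ENNReal.ofReal_ne_top, ← mul_assoc, ← sq,
          K.lintegral_weight (hh.pow_const 2)]

/-! ### The convolution as a bounded map of the weighted space. -/

section Conv

variable {V : Type*} [NormedAddCommGroup V] [NormedSpace ℝ V]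

/-- The exponential convolution `∫₀ˢ exp (-l (s - τ)) H(τ) dτ`. -/
def expConv (l : ℝ) (H : ℝ → V) (s : ℝ) : V :=
  Real.exp (-l * s) • ∫ τ in (0 : ℝ)..s, Real.exp (l * τ) • H τ

variable {K : MemoryKernel}

theorem intervalIntegrable_exp_smul (l : ℝ) (H : Lp V 2 K.weight) {s : ℝ} (hs : 0 ≤ s) :
    IntervalIntegrable (fun τ => Real.exp (l * τ) • H τ) volume 0 s :=
  (K.intervalIntegrable_lp H hs).continuousOn_smul (by fun_prop)

theorem continuousOn_expConv (l : ℝ) (H : Lp V 2 K.weight) :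
    ContinuousOn (expConv l H) (Ici 0) :=
  ContinuousOn.smul (by fun_prop)
    (continuousOn_primitive_Ici fun _ hs => intervalIntegrable_exp_smul l H hs)

theorem aestronglyMeasurable_expConv (l : ℝ) (H : Lp V 2 K.weight) :
    AEStronglyMeasurable (expConv l H) K.weight :=
  (((continuousOn_expConv l H).mono Ioi_subset_Ici_self).aestronglyMeasurable
    measurableSet_Ioi).mono_ac K.weight_absolutelyContinuous_restrict

theorem enorm_expConv_le (l : ℝ) (H : ℝ → V) {s : ℝ} (hs : 0 ≤ s) :
    ‖expConv l H s‖ₑ ≤ ENNReal.ofReal (Real.exp (-l * s)) *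
      ∫⁻ τ in Ioc 0 s, ENNReal.ofReal (Real.exp (l * τ)) * ‖H τ‖ₑ := by
  rw [expConv, enorm_smul, Real.enorm_of_nonneg (Real.exp_pos _).le,
    intervalIntegral.integral_of_le hs]
  gcongr
  refine (enorm_integral_le_lintegral_enorm _).trans_eq ?_
  simp only [enorm_smul, Real.enorm_of_nonneg (Real.exp_pos _).le]

theorem eLpNorm_expConv_le {l : ℝ} (hl : 0 < l) (H : Lp V 2 K.weight) :
    eLpNorm (expConv l H) 2 K.weight ≤ ENNReal.ofReal l⁻¹ * eLpNorm H 2 K.weight := by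
  have key : ∀ F : ℝ → V, eLpNorm F 2 K.weight ^ 2 = ∫⁻ s, ‖F s‖ₑ ^ 2 ∂K.weight := fun F => by
    rw [eLpNorm_eq_lintegral_rpow_enorm_toReal two_ne_zero ENNReal.ofNat_ne_top,
      ← ENNReal.rpow_two, ← ENNReal.rpow_mul]
    norm_num
  rw [← ENNReal.pow_le_pow_left_iff two_ne_zero, mul_pow, key, key]
  refine le_trans ?_ (K.lintegral_conv_sq_le hl
    ((Lp.aestronglyMeasurable H).mono_ac K.restrict_absolutelyContinuous_weight).enorm)
  refine lintegral_mono_ae (K.ae_weight_iff.2 ?_)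
  filter_upwards [ae_restrict_mem measurableSet_Ioi] with s hs
  gcongr
  exact enorm_expConv_le l H (le_of_lt hs)

theorem memLp_expConv {l : ℝ} (hl : 0 < l) (H : Lp V 2 K.weight) :
    MemLp (expConv l H) 2 K.weight :=
  ⟨aestronglyMeasurable_expConv l H, (eLpNorm_expConv_le hl H).trans_lt
    (ENNReal.mul_lt_top ENNReal.ofReal_lt_top (Lp.memLp H).2)⟩

theorem norm_le_of_ae_eq_expConv {l : ℝ} (hl : 0 < l) {η H : Lp V 2 K.weight}
    (h : η =ᵐ[K.weight] expConv l H) : l * ‖η‖ ≤ ‖H‖ := by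
  have h1 := eLpNorm_expConv_le hl H
  rw [← eLpNorm_congr_ae h] at h1
  have h2 := ENNReal.toReal_mono (ENNReal.mul_ne_top ENNReal.ofReal_ne_top (Lp.memLp H).2.ne) h1
  rw [ENNReal.toReal_mul, ENNReal.toReal_ofReal (inv_nonneg.2 hl.le), inv_mul_eq_div,
    le_div_iff₀' hl] at h2
  exact h2

end Conv

/-! ### The operator `∂ₛ` with zero trace -/

section Derivative

variable {V : Type*} [NormedAddCommGroup V] [InnerProductSpace ℂ V] {K : MemoryKernel}

theorem primitive_congr_ae {W : Type*} [NormedAddCommGroup W] [NormedSpace ℝ W]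
    {ζ ζ' : ℝ → W} (h : ∀ᵐ s ∂volume.restrict (Ioi (0 : ℝ)), ζ s = ζ' s) {s : ℝ} (hs : 0 ≤ s) :
    ∫ τ in (0 : ℝ)..s, ζ τ = ∫ τ in (0 : ℝ)..s, ζ' τ := by
  refine intervalIntegral.integral_congr_ae_restrict ?_
  rw [uIoc_of_le hs]
  exact ae_restrict_of_ae_restrict_of_subset Ioc_subset_Ioi_self h

/-- The relation `η(s) = ∫₀ˢ ζ(τ) dτ` in the weighted space, as a set of pairs `(η, -ζ)`. -/
def derivGraph (V : Type*) [NormedAddCommGroup V] [InnerProductSpace ℂ V] (K : MemoryKernel) :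
    Submodule ℂ (Lp V 2 K.weight × Lp V 2 K.weight) where
  carrier := {p | ∀ᵐ s ∂volume.restrict (Ioi (0 : ℝ)), p.1 s = ∫ τ in (0 : ℝ)..s, -p.2 τ}
  zero_mem' := by
    have h0 := K.ae_weight_iff.1 (Lp.coeFn_zero V 2 K.weight)
    filter_upwards [h0, ae_restrict_mem measurableSet_Ioi] with s h1 hs
    rw [primitive_congr_ae (ζ' := fun _ => (0 : V)) ?_ (le_of_lt hs)]
    · simpa using h1
    · filter_upwards [h0] with s h1
      change -((0 : Lp V 2 K.weight) s) = 0
      rw [h1, Pi.zero_apply, neg_zero]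
  add_mem' := by
    rintro ⟨η, ζ⟩ ⟨η', ζ'⟩ h h'
    filter_upwards [h, h', K.ae_weight_iff.1 (Lp.coeFn_add η η'),
      ae_restrict_mem measurableSet_Ioi] with s h1 h2 h3 hs
    rw [primitive_congr_ae (ζ' := fun τ => -ζ τ + -ζ' τ) ?_ (le_of_lt hs)]
    · have hi : ∀ ξ : Lp V 2 K.weight, IntervalIntegrable (fun τ => -ξ τ) volume 0 s := fun ξ =>
        (K.intervalIntegrable_lp ξ (le_of_lt hs)).neg
      rw [intervalIntegral.integral_add (hi ζ) (hi ζ'), ← h1, ← h2]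
      exact h3
    · filter_upwards [K.ae_weight_iff.1 (Lp.coeFn_add ζ ζ')] with s h4
      change -((ζ + ζ' : Lp V 2 K.weight) s) = _
      rw [h4, Pi.add_apply, neg_add]
  smul_mem' := by
    rintro c ⟨η, ζ⟩ h
    filter_upwards [h, K.ae_weight_iff.1 (Lp.coeFn_smul c η),
      ae_restrict_mem measurableSet_Ioi] with s h1 h3 hs
    rw [primitive_congr_ae (ζ' := fun τ => c • -ζ τ) ?_ (le_of_lt hs)]
    · rw [intervalIntegral.integral_smul, ← h1]
      exact h3
    · filter_upwards [K.ae_weight_iff.1 (Lp.coeFn_smul c ζ)] with s h4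
      change -((c • ζ : Lp V 2 K.weight) s) = _
      rw [h4, Pi.smul_apply, smul_neg]

variable [CompleteSpace V]

/-- The resolvent equation `l η + ∂ₛ η = H`, `η(0) = 0`. -/
theorem exists_mem_derivGraph {l : ℝ} (hl : 0 < l) (H : Lp V 2 K.weight) :
    ∃ η ζ, (η, ζ) ∈ derivGraph V K ∧ (l : ℂ) • η - ζ = H := by
  set η : Lp V 2 K.weight := (memLp_expConv hl H).toLp _ with hη
  have hη' : ∀ᵐ s ∂volume.restrict (Ioi (0 : ℝ)), η s = expConv l H s :=
    K.ae_weight_iff.1 (memLp_expConv hl H).coeFn_toLp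
  refine ⟨η, (l : ℂ) • η - H, ?_, sub_sub_cancel _ _⟩
  filter_upwards [hη', ae_restrict_mem measurableSet_Ioi] with s h1 hs
  have hs0 : 0 ≤ s := le_of_lt hs
  change η s = _
  -- Integrating by parts against `exp (-l x)` shows that the convolution is the primitive of `H - l
  -- η`.
  rw [h1, expConv, smul_primitive_eq (φ := fun x => Real.exp (-l * x))
    (φ' := fun x => -l * Real.exp (-l * x)) (fun x => ?_)
    (by fun_prop) hs0 (intervalIntegrable_exp_smul l H hs0)]
  · refine (primitive_congr_ae ?_ hs0).symm
    filter_upwards [hη', K.ae_weight_iff.1 (Lp.coeFn_smul (l : ℂ) η),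
      K.ae_weight_iff.1 (Lp.coeFn_sub ((l : ℂ) • η) H)] with τ h2 h3 h4
    change -(((l : ℂ) • η - H : Lp V 2 K.weight) τ) = _
    rw [h4, Pi.sub_apply, h3, Pi.smul_apply, h2, Complex.coe_smul, expConv, smul_smul, smul_smul,
      ← Real.exp_add]
    simp [neg_smul, neg_add_eq_sub]
  · simpa [mul_comm] using ((hasDerivAt_id x).const_mul (-l)).exp

/-- With the integrating factor `exp (l x)`, `η` is the exponential convolution of `l η - ζ`, so the
bound on convolutions applies. -/
theorem mul_norm_le_of_mem_derivGraph {η ζ : Lp V 2 K.weight} (h : (η, ζ) ∈ derivGraph V K) {l : ℝ}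
    (hl : 0 < l) : l * ‖η‖ ≤ ‖(l : ℂ) • η - ζ‖ := by
  refine norm_le_of_ae_eq_expConv hl (K.ae_weight_iff.2 ?_)
  filter_upwards [h, ae_restrict_mem measurableSet_Ioi] with s h1 hs
  have hs0 : 0 ≤ s := le_of_lt hs
  have h2 := smul_primitive_eq (φ := fun x => Real.exp (l * x))
    (φ' := fun x => l * Real.exp (l * x))
    (fun x => by simpa [mul_comm] using ((hasDerivAt_id x).const_mul l).exp)
    (by fun_prop) hs0 (K.intervalIntegrable_lp ζ hs0).neg
  have h3 : ∫ τ in (0 : ℝ)..s, Real.exp (l * τ) • ((l : ℂ) • η - ζ : Lp V 2 K.weight) τ =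
      Real.exp (l * s) • η s := by
    change η s = _ at h1
    rw [h1]
    refine Eq.trans (primitive_congr_ae ?_ hs0) h2.symm
    filter_upwards [h, K.ae_weight_iff.1 (Lp.coeFn_smul (l : ℂ) η),
      K.ae_weight_iff.1 (Lp.coeFn_sub ((l : ℂ) • η) ζ)] with τ h5 h3 h4
    change η τ = _ at h5
    rw [h4, Pi.sub_apply, h3, Pi.smul_apply, Complex.coe_smul, h5]
    simp only [Pi.neg_apply, smul_add, smul_neg, sub_eq_add_neg, mul_smul]
    rw [smul_comm]
  rw [expConv, h3, smul_smul, ← Real.exp_add]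
  simp

/-- The operator `-∂ₛ` with zero trace is dissipative since the weight is nonincreasing. -/
theorem isDissipative_derivGraph : IsDissipative (derivGraph V K) := by
  intro η ζ h
  by_contra hc
  rw [not_le] at hc
  set r := (⟪η, ζ⟫_ℂ).re with hr
  -- Squaring `l ‖η‖ ≤ ‖l η - ζ‖` gives `2 l r ≤ ‖ζ‖²` for every `l > 0`. This `l` makes the left
  -- side `‖ζ‖² + 1`; no boundary terms at infinity have to be handled.
  set l := (‖ζ‖ ^ 2 + 1) / (2 * r) with hl
  have hlpos : 0 < l := by positivity
  have h1 := mul_norm_le_of_mem_derivGraph h hlpos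
  have h2 : ‖(l : ℂ) • η - ζ‖ ^ 2 = (l * ‖η‖) ^ 2 - 2 * l * r + ‖ζ‖ ^ 2 := by
    rw [@norm_sub_sq ℂ, norm_smul, Complex.norm_real, Real.norm_of_nonneg hlpos.le, inner_smul_left]
    have : RCLike.re ((starRingEnd ℂ) (l : ℂ) * ⟪η, ζ⟫_ℂ) = l * r := by
      rw [Complex.conj_ofReal]
      exact Complex.re_ofReal_mul _ _
    rw [this]
    ring
  have h3 : 2 * l * r = ‖ζ‖ ^ 2 + 1 := by
    rw [hl]; field_simp
  have h4 := pow_le_pow_left₀ (by positivity) h1 2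
  linarith

end Derivative

/-! ### The Sobolev spaces: density of test functions, inclusions, weak formulation -/

section Sobolev

variable {d : ℕ}

theorem inner_lap (Ω : BoundedDomain d) (χ ψ : Test Ω) :
    ⟪testL2 Ω (lap Ω χ), testL2 Ω ψ⟫_ℂ = ⟪testL2 Ω χ, testL2 Ω (lap Ω ψ)⟫_ℂ := by
  simp only [lap, map_sum, sum_inner, inner_sum]
  exact Finset.sum_congr rfl fun i _ => by rw [inner_lineDeriv, inner_lineDeriv, neg_neg]

/-- Complex conjugation of test functions, as an additive map. -/
def conjTestHom (Ω : BoundedDomain d) : Test Ω →+ Test Ω where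
  toFun := conjTest
  map_zero' := by ext x; exact map_zero (starRingEnd ℂ)
  map_add' φ ψ := by ext x; exact map_add (starRingEnd ℂ) _ _

theorem conjTest_conjTest {Ω : BoundedDomain d} (φ : Test Ω) : conjTest (conjTest φ) = φ := by
  ext x; exact Complex.conj_conj _

theorem conjTest_lineDeriv {Ω : BoundedDomain d} (φ : Test Ω) (v : EuclideanSpace ℝ (Fin d)) :
    conjTest (∂_{v} φ) = ∂_{v} (conjTest φ) := by
  ext x
  have hφ : Differentiable ℝ φ := φ.contDiff.differentiable (by simp)
  have h1 := (Complex.conjCLE.toContinuousLinearMap.hasFDerivAt.comp x (hφ x).hasFDerivAt).fderiv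
  change (starRingEnd ℂ) ((∂_{v} φ : Test Ω) x) = _
  rw [lineDeriv_test, lineDeriv_test]
  change _ = fderiv ℝ (Complex.conjCLE.toContinuousLinearMap ∘ φ) x v
  rw [h1]
  rfl

/-- The distributional pairing is bilinear and the inner product sesquilinear; passing between them
puts a conjugate on the test function, which must commute with `Δ`. -/
theorem conjTest_lap {Ω : BoundedDomain d} (φ : Test Ω) :
    conjTest (lap Ω φ) = lap Ω (conjTest φ) := by
  change conjTestHom Ω (lap Ω φ) = _
  rw [lap, map_sum]
  refine Finset.sum_congr rfl fun i _ => ?_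
  change conjTest _ = _
  rw [conjTest_lineDeriv, conjTest_lineDeriv]

theorem conjTest_iterate_lap {Ω : BoundedDomain d} (φ : Test Ω) (k : ℕ) :
    conjTest ((lap Ω)^[k] φ) = (lap Ω)^[k] (conjTest φ) := by
  induction k generalizing φ with
  | zero => rfl
  | succ k ih => rw [Function.iterate_succ_apply, Function.iterate_succ_apply, ih, conjTest_lap]

variable [NeZero d]

/-- The space `H_k`, as a topological vector space, is `sobolevZero Ω k`. -/
def HSpace.equiv (Ω : BoundedDomain d) (k : Fin 3) : HSpace Ω k ≃L[ℂ] sobolevZero Ω k :=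
  let e : HSpace Ω k ≃ₗ[ℂ] sobolevZero Ω k := LinearEquiv.refl ℂ _
  { e with
    continuous_toFun := by
      obtain ⟨C, hC⟩ := poincare Ω k
      rw [continuous_induced_rng]
      have : Continuous fun u : HSpace Ω k => WithLp.ofLp (e u).1 := by
        refine continuous_pi fun a => ?_
        let ea : HSpace Ω k →ₗ[ℂ] L2 Ω :=
          (PiLp.proj 2 (fun _ : MultiIdx d k => L2 Ω) a).toLinearMap ∘ₗ (sobolevZero Ω k).subtype
        exact AddMonoidHomClass.continuous_of_bound ea C fun u => hC u.1 u.2 a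
      exact (PiLp.continuous_toLp 2 _).comp this
    continuous_invFun := AddMonoidHomClass.continuous_of_bound e.symm ‖energyDeriv Ω k‖
      fun u => (energyDeriv Ω k).le_opNorm u.1 }

/-- A test function as an element of `H_k`. -/
def testH (Ω : BoundedDomain d) (k : Fin 3) (φ : Test Ω) : HSpace Ω k :=
  (⟨jet Ω k φ, subset_closure ⟨φ, rfl⟩⟩ : sobolevZero Ω k)

theorem denseRange_testH (Ω : BoundedDomain d) (k : Fin 3) : DenseRange (testH Ω k) := by
  have h1 : DenseRange fun φ : Test Ω =>
      (⟨jet Ω k φ, subset_closure ⟨φ, rfl⟩⟩ : sobolevZero Ω k) := by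
    intro u
    rw [closure_subtype, ← range_comp]
    exact u.2
  exact (HSpace.equiv Ω k).symm.surjective.denseRange.comp h1 (HSpace.equiv Ω k).symm.continuous

theorem toL2_testH (Ω : BoundedDomain d) (k : Fin 3) (φ : Test Ω) :
    HSpace.toL2 Ω k (testH Ω k φ) = testL2 Ω φ := rfl

/-- For `k = 1` one derivative is moved across, which gives the sign; for `k = 2` a whole Laplacian
is moved, with no sign. -/
theorem inner_testH (Ω : BoundedDomain d) (k : Fin 3) (χ ψ : Test Ω) :
    ⟪testL2 Ω ((lap Ω)^[(k : ℕ)] χ), testL2 Ω ψ⟫_ℂ =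
      (-1) ^ (k : ℕ) * ⟪testH Ω k χ, testH Ω k ψ⟫_ℂ := by
  have e : ⟪testH Ω k χ, testH Ω k ψ⟫_ℂ =
      ⟪energyDeriv Ω k (jet Ω k χ), energyDeriv Ω k (jet Ω k ψ)⟫_ℂ := rfl
  rw [e, PiLp.inner_apply]
  match k with
  | 0 =>
    change _ = (-1) ^ 0 * ∑ _ : Unit, ⟪testL2 Ω χ, testL2 Ω ψ⟫_ℂ
    simp
  | 1 =>
    change ⟪testL2 Ω (lap Ω χ), testL2 Ω ψ⟫_ℂ = (-1) ^ 1 *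
      ∑ i : Fin d, ⟪testL2 Ω (∂_{basisVec i} χ), testL2 Ω (∂_{basisVec i} ψ)⟫_ℂ
    simp only [lap, map_sum, sum_inner, inner_lineDeriv (∂_{basisVec _} χ), pow_one, neg_one_mul,
      Finset.sum_neg_distrib]
  | 2 =>
    have h : ∀ φ : Test Ω, energyDeriv Ω 2 (jet Ω 2 φ) () = testL2 Ω (lap Ω φ) := fun φ => by
      simp [energyDeriv, lap, jet_apply]
      rfl
    change ⟪testL2 Ω (lap Ω (lap Ω χ)), testL2 Ω ψ⟫_ℂ = (-1) ^ 2 *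
      ∑ _ : Unit, ⟪energyDeriv Ω 2 (jet Ω 2 χ) (), energyDeriv Ω 2 (jet Ω 2 ψ) ()⟫_ℂ
    rw [h, h, inner_lap]
    simp

/-- Integration by parts in `H_k`. -/
theorem pairing_toL2_lap (Ω : BoundedDomain d) (k : Fin 3) (u : HSpace Ω k) (φ : Test Ω) :
    pairing (HSpace.toL2 Ω k u) ((lap Ω)^[(k : ℕ)] φ) =
      (-1) ^ (k : ℕ) * ⟪testH Ω k (conjTest φ), u⟫_ℂ := by
  rw [pairing_eq_inner, conjTest_iterate_lap]
  refine (denseRange_testH Ω k).induction_on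
    (p := fun u => ⟪testL2 Ω ((lap Ω)^[(k : ℕ)] (conjTest φ)), HSpace.toL2 Ω k u⟫_ℂ =
      (-1) ^ (k : ℕ) * ⟪testH Ω k (conjTest φ), u⟫_ℂ) u ?_ fun ψ => ?_
  · exact isClosed_eq (continuous_const.inner (HSpace.toL2 Ω k).continuous)
      (continuous_const.mul (continuous_const.inner continuous_id))
  · rw [toL2_testH, inner_testH]

/-- The inclusion `H_2 ⊆ H_k`. -/
def HSpace.inclusion (Ω : BoundedDomain d) (k : Fin 3) : HSpace Ω 2 →L[ℂ] HSpace Ω k :=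
  let r : PiLp 2 (fun _ : MultiIdx d (2 : Fin 3) => L2 Ω) →L[ℂ]
      PiLp 2 (fun _ : MultiIdx d k => L2 Ω) :=
    (PiLp.continuousLinearEquiv 2 ℂ _).symm.toContinuousLinearMap ∘L
      ContinuousLinearMap.pi fun a : MultiIdx d k =>
        PiLp.proj 2 _ (⟨Fin.castLE (by omega) a.1, a.2⟩ : MultiIdx d (2 : Fin 3))
  (HSpace.equiv Ω k).symm.toContinuousLinearMap ∘L
    (r ∘L (sobolevZero Ω (2 : Fin 3)).subtypeL ∘L
      (HSpace.equiv Ω 2).toContinuousLinearMap).codRestrict (sobolevZero Ω k) fun u => by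
        -- Truncating a jet of a test function gives its lower-order jet; by continuity closures are
        -- mapped to closures.
        have h : MapsTo r (LinearMap.range (jet Ω (2 : Fin 3)) : Set _)
            (LinearMap.range (jet Ω k) : Set _) := by
          rintro _ ⟨φ, rfl⟩
          exact ⟨φ, rfl⟩
        have hm : r (HSpace.equiv Ω 2 u).1 ∈ sobolevZero Ω k :=
          map_mem_closure r.continuous (HSpace.equiv Ω 2 u).2 h
        exact hm

theorem HSpace.toL2_inclusion (Ω : BoundedDomain d) (k : Fin 3) (u : HSpace Ω 2) :
    HSpace.toL2 Ω k (HSpace.inclusion Ω k u) = HSpace.toL2 Ω 2 u := rfl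

theorem HSpace.inclusion_testH (Ω : BoundedDomain d) (k : Fin 3) (φ : Test Ω) :
    HSpace.inclusion Ω k (testH Ω 2 φ) = testH Ω k φ := rfl

end Sobolev

/-! ### The coupled system -/

/-- Lax–Milgram: coercivity bounds `B` from below, so its range is closed, and a vector orthogonal
to the range is killed by testing with itself. -/
theorem surjective_of_coercive {Y : Type*} [NormedAddCommGroup Y] [InnerProductSpace ℂ Y]
    [CompleteSpace Y] (B : Y →L[ℂ] Y) {c : ℝ} (hc : 0 < c)
    (h : ∀ y, c * ‖y‖ ^ 2 ≤ (⟪y, B y⟫_ℂ).re) : Function.Surjective B := by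
  have hb : ∀ y, c * ‖y‖ ≤ ‖B y‖ := by
    intro y
    rcases (norm_nonneg y).eq_or_lt with h0 | h0
    · rw [← h0, mul_zero]; exact norm_nonneg _
    have h1 := (Complex.re_le_norm _).trans (norm_inner_le_norm (𝕜 := ℂ) y (B y))
    nlinarith [h y]
  have hanti : AntilipschitzWith ⟨c⁻¹, by positivity⟩ B :=
    B.antilipschitz_of_bound fun y => by
      change ‖y‖ ≤ c⁻¹ * ‖B y‖
      rw [inv_mul_eq_div, le_div_iff₀' hc]
      exact hb y
  have hcl : IsClosed (B.range : Set Y) := hanti.isClosed_range B.uniformContinuous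
  have := hcl.completeSpace_coe
  refine (LinearMap.range_eq_top (f := (B : Y →ₗ[ℂ] Y))).1 ?_
  rw [← B.range.orthogonal_orthogonal, Submodule.eq_top_iff']
  intro v w hw
  have h0 : ⟪w, B w⟫_ℂ = 0 := by
    have h1 : ⟪B w, w⟫_ℂ = 0 := (Submodule.mem_orthogonal _ _).1 hw _ ⟨w, rfl⟩
    rw [← inner_conj_symm, h1, map_zero]
  have h1 := h w
  rw [h0, Complex.zero_re] at h1
  have h2 : ‖w‖ ^ 2 ≤ 0 := by
    by_contra hn
    nlinarith [mul_pos hc (not_le.1 hn)]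
  have h3 : w = 0 := norm_eq_zero.1
    (pow_eq_zero_iff two_ne_zero |>.1 (le_antisymm h2 (sq_nonneg _)))
  rw [h3, inner_zero_left]

section Coupled

variable {H Y V L : Type*} [NormedAddCommGroup H] [InnerProductSpace ℂ H]
  [NormedAddCommGroup Y] [InnerProductSpace ℂ Y]
  [NormedAddCommGroup V] [InnerProductSpace ℂ V]
  [NormedAddCommGroup L] [InnerProductSpace ℂ L]

/-- The relation `U = (ι y, η) ↦ W = (w, C y + ζ)`, where `(η, ζ) ∈ D` and, weakly,
`w = -i (S* S y + y) - C* η`. -/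
def IsCoupledImage (ι : Y →L[ℂ] H) (S : Y →L[ℂ] V) (C : Y →L[ℂ] L) (D : Submodule ℂ (L × L))
    (U W : WithLp 2 (H × L)) : Prop :=
  ∃ y, U.fst = ι y ∧ (∀ φ, ⟪ι φ, W.fst⟫_ℂ = -Complex.I * ⟪S φ, S y⟫_ℂ - Complex.I * ⟪φ, y⟫_ℂ -
    ⟪C φ, U.snd⟫_ℂ) ∧ (U.snd, W.snd - C y) ∈ D

variable {ι : Y →L[ℂ] H} {S : Y →L[ℂ] V} {C : Y →L[ℂ] L} {D : Submodule ℂ (L × L)}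

/-- Take `φ = y`. The squared norms enter multiplied by `-i`, the two coupling terms have opposite
real parts, and only the contribution of `D` is left. -/
theorem IsCoupledImage.re_inner_nonpos (hD : IsDissipative D) {U W : WithLp 2 (H × L)}
    (h : IsCoupledImage ι S C D U W) : (⟪U, W⟫_ℂ).re ≤ 0 := by
  obtain ⟨y, h1, h2, h3⟩ := h
  have h4 : ⟪U.snd, W.snd⟫_ℂ = ⟪U.snd, W.snd - C y⟫_ℂ + ⟪U.snd, C y⟫_ℂ := by
    rw [inner_sub_right, sub_add_cancel]
  have h5 := hD _ _ h3
  have h6 : (⟪C y, U.snd⟫_ℂ).re = (⟪U.snd, C y⟫_ℂ).re := by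
    rw [← inner_conj_symm, Complex.conj_re]
  rw [WithLp.prod_inner_apply]
  change (⟪U.fst, W.fst⟫_ℂ + ⟪U.snd, W.snd⟫_ℂ).re ≤ 0
  rw [h1, h2 y, h4, inner_self_eq_norm_sq_to_K, inner_self_eq_norm_sq_to_K]
  simp only [Complex.coe_algebraMap, Complex.add_re, Complex.sub_re, ← Complex.ofReal_pow,
    neg_mul, Complex.neg_re, Complex.I_mul_re, Complex.ofReal_im]
  linarith

-- The second component forces `η = l⁻¹ J (C y + Z₂)`. Substituting this in the first and
-- multiplying by `i` leaves `B y = -i (ι* Z₁ - l⁻¹ C* J Z₂)`.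
open ContinuousLinearMap in
theorem exists_isCoupledImage [CompleteSpace H] [CompleteSpace Y] [CompleteSpace V]
    [CompleteSpace L] (hD : IsDissipative D) {l : ℝ} (hl : 2 * ‖C‖ ^ 2 + 1 ≤ l)
    (hR : ∀ z, ∃ x y, (x, y) ∈ D ∧ (l : ℂ) • x - y = z) (Z : WithLp 2 (H × L)) :
    ∃ U W, IsCoupledImage ι S C D U W ∧ (l : ℂ) • U - W = Z := by
  have hl0 : 0 < l := lt_of_lt_of_le (by positivity) hl
  have hlc : (l : ℂ) ≠ 0 := by exact_mod_cast hl0.ne'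
  obtain ⟨J, hJ1, hJ2, -⟩ := hD.exists_resolvent hl0 hR
  let B : Y →L[ℂ] Y := 1 + adjoint S ∘L S -
    Complex.I • ((l : ℂ) • adjoint ι ∘L ι + (l : ℂ)⁻¹ • adjoint C ∘L J ∘L C)
  have hB : ∀ φ y, ⟪φ, B y⟫_ℂ = ⟪φ, y⟫_ℂ + ⟪S φ, S y⟫_ℂ -
      Complex.I * (l * ⟪ι φ, ι y⟫_ℂ + (l : ℂ)⁻¹ * ⟪C φ, J (C y)⟫_ℂ) := by
    intro φ y
    simp [B, adjoint_inner_right]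
    ring
  -- The term with `ι` drops out of the real part. The only indefinite term is at most `l⁻¹ ‖C‖²
  -- ‖y‖²`, which `l ≥ 2 ‖C‖²` makes at most half of `‖y‖²`; the extra `1` in the bound keeps `l`
  -- positive.
  have hcoer : ∀ y, (1 / 2 : ℝ) * ‖y‖ ^ 2 ≤ (⟪y, B y⟫_ℂ).re := by
    intro y
    rw [hB, inner_self_eq_norm_sq_to_K, inner_self_eq_norm_sq_to_K, inner_self_eq_norm_sq_to_K]
    simp only [Complex.coe_algebraMap, Complex.add_re, Complex.sub_re, ← Complex.ofReal_pow,
      Complex.I_mul_re, Complex.ofReal_re, Complex.add_im, ← Complex.ofReal_mul, Complex.ofReal_im,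
      ← Complex.ofReal_inv, Complex.im_ofReal_mul]
    have h1 := (neg_le_abs _).trans ((Complex.abs_im_le_norm _).trans
      (norm_inner_le_norm (𝕜 := ℂ) (C y) (J (C y))))
    have h2 : ‖C y‖ * ‖J (C y)‖ ≤ ‖C‖ ^ 2 * ‖y‖ ^ 2 := by
      rw [← mul_pow, sq]
      exact mul_le_mul (C.le_opNorm y) ((hJ1 _).trans (C.le_opNorm y)) (norm_nonneg _)
        (by positivity)
    have h3 : l⁻¹ * (‖C‖ ^ 2 * ‖y‖ ^ 2) ≤ 1 / 2 * ‖y‖ ^ 2 := by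
      rw [inv_mul_eq_div, div_le_iff₀ hl0]
      nlinarith [sq_nonneg ‖y‖]
    have h4 := mul_le_mul_of_nonneg_left (h1.trans h2) (inv_nonneg.2 hl0.le)
    nlinarith [sq_nonneg ‖S y‖]
  obtain ⟨y, hy⟩ := surjective_of_coercive B (by norm_num) hcoer
    (-Complex.I • (adjoint ι Z.fst - (l : ℂ)⁻¹ • adjoint C (J Z.snd)))
  refine ⟨WithLp.toLp 2 (ι y, (l : ℂ)⁻¹ • J (C y + Z.snd)),
    WithLp.toLp 2 ((l : ℂ) • ι y - Z.fst, J (C y + Z.snd) - Z.snd), ⟨y, rfl, fun φ => ?_, ?_⟩, ?_⟩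
  · have h1 := hB φ y
    rw [hy, inner_smul_right, inner_sub_right, inner_smul_right, adjoint_inner_right,
      adjoint_inner_right] at h1
    change ⟪ι φ, (l : ℂ) • ι y - Z.fst⟫_ℂ = _ - ⟪C φ, (l : ℂ)⁻¹ • J (C y + Z.snd)⟫_ℂ
    rw [inner_sub_right, inner_smul_right, inner_smul_right, map_add, inner_add_right]
    linear_combination -Complex.I * h1 + (l * ⟪ι φ, ι y⟫_ℂ + (l : ℂ)⁻¹ * ⟪C φ, J (C y)⟫_ℂ -
      ⟪ι φ, Z.fst⟫_ℂ + (l : ℂ)⁻¹ * ⟪C φ, J Z.snd⟫_ℂ) * Complex.I_mul_I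
  · have h1 := D.smul_mem (l : ℂ)⁻¹ (hJ2 (C y + Z.snd))
    rw [Prod.smul_mk, inv_smul_smul₀ hlc] at h1
    change ((l : ℂ)⁻¹ • J (C y + Z.snd), J (C y + Z.snd) - Z.snd - C y) ∈ D
    rwa [sub_sub, add_comm Z.snd]
  · refine WithLp.ofLp_injective 2 (Prod.ext ?_ ?_)
    · change (l : ℂ) • ι y - ((l : ℂ) • ι y - Z.fst) = Z.fst
      abel
    · change (l : ℂ) • ((l : ℂ)⁻¹ • J (C y + Z.snd)) - (J (C y + Z.snd) - Z.snd) = Z.snd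
      rw [smul_inv_smul₀ hlc]
      abel

end Coupled

/-! ### The biharmonic Schrödinger equation with memory -/

section Application

variable {d : ℕ} [NeZero d] {Ω : BoundedDomain d} {K : MemoryKernel} {j : Fin 3}

/-- The embedding of `H_2` in `L_j` as functions constant in `s`. -/
def constMemory (Ω : BoundedDomain d) (K : MemoryKernel) (j : Fin 3) :
    HSpace Ω 2 →L[ℂ] MemorySpace Ω K j :=
  Lp.constL 2 K.weight ℂ ∘L HSpace.inclusion Ω j

theorem coeFn_constMemory (y : HSpace Ω 2) :
    ∀ᵐ s ∂volume.restrict (Ioi (0 : ℝ)), constMemory Ω K j y s = HSpace.inclusion Ω j y :=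
  K.ae_weight_iff.1 (Lp.coeFn_const (p := 2) (μ := K.weight) (HSpace.inclusion Ω j y))

/-- Integration by parts at each `s`. The sign `(-1)^j` cancels against the `(-1)^(j+1)` of the
operator, so the memory term acts as `-C*` for every `j`. -/
theorem memoryPairing_eq_inner (η : MemorySpace Ω K j) (φ : Test Ω) :
    memoryPairing η φ = (-1) ^ (j : ℕ) * ⟪constMemory Ω K j (testH Ω 2 (conjTest φ)), η⟫_ℂ := by
  have h : ⟪constMemory Ω K j (testH Ω 2 (conjTest φ)), η⟫_ℂ =
      ∫ s, ⟪testH Ω j (conjTest φ), η s⟫_ℂ ∂K.weight := by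
    rw [L2.inner_def]
    refine integral_congr_ae (K.ae_weight_iff.2 ?_)
    filter_upwards [coeFn_constMemory (K := K) (j := j) (testH Ω 2 (conjTest φ))] with s hs
    rw [hs, HSpace.inclusion_testH]
  rw [h, K.integral_weight, memoryPairing, ← integral_const_mul]
  refine integral_congr_ae (ae_of_all _ fun s => ?_)
  simp only [pairing_toL2_lap]
  ring

/-- The derivative in `s` is taken in `L²(Ω)` on one side and in `H_j` on the other. As `y - W` is
already locally integrable in `H_j`, its primitive exists there, and the continuous injection into
`L²(Ω)` commutes with the integral. -/
theorem hasDerivZeroTrace_iff (y : HSpace Ω 2) (η W : MemorySpace Ω K j) :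
    HasDerivZeroTrace (fun s => HSpace.toL2 Ω j (η s))
      (fun s => HSpace.toL2 Ω 2 y - HSpace.toL2 Ω j (W s)) ↔
      (η, W - constMemory Ω K j y) ∈ derivGraph (HSpace Ω j) K := by
  have hint : ∀ s, 0 ≤ s → IntervalIntegrable (fun τ => HSpace.inclusion Ω j y - W τ) volume 0 s :=
    fun s hs => intervalIntegrable_const.sub (K.intervalIntegrable_lp W hs)
  have heq : ∀ τ, HSpace.toL2 Ω 2 y - HSpace.toL2 Ω j (W τ) =
      HSpace.toL2 Ω j (HSpace.inclusion Ω j y - W τ) := fun τ => by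
    rw [map_sub, HSpace.toL2_inclusion]
  have hcomm : ∀ s, 0 ≤ s → ∫ τ in (0 : ℝ)..s, (HSpace.toL2 Ω 2 y - HSpace.toL2 Ω j (W τ)) =
      HSpace.toL2 Ω j (∫ τ in (0 : ℝ)..s, (HSpace.inclusion Ω j y - W τ)) := fun s hs => by
    simp only [heq]
    exact (HSpace.toL2 Ω j).intervalIntegral_comp_comm (hint s hs)
  have hcongr : ∀ s, 0 ≤ s → ∫ τ in (0 : ℝ)..s, -(W - constMemory Ω K j y : MemorySpace Ω K j) τ =
      ∫ τ in (0 : ℝ)..s, (HSpace.inclusion Ω j y - W τ) := fun s hs => by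
    refine primitive_congr_ae ?_ hs
    filter_upwards [coeFn_constMemory (K := K) (j := j) y,
      K.ae_weight_iff.1 (Lp.coeFn_sub W (constMemory Ω K j y))] with τ h1 h2
    rw [h2, Pi.sub_apply, h1, neg_sub]
  constructor
  · rintro ⟨u, h1, h2, h3⟩
    filter_upwards [h1, ae_restrict_mem measurableSet_Ioi] with s h4 hs
    change η s = ∫ τ in (0 : ℝ)..s, -(W - constMemory Ω K j y : MemorySpace Ω K j) τ
    apply HSpace.toL2_injective Ω j
    rw [h4, (h2 s (le_of_lt hs)).2, h3, zero_add, hcomm s (le_of_lt hs), hcongr s (le_of_lt hs)]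
  · intro h
    refine ⟨fun s => ∫ τ in (0 : ℝ)..s, (HSpace.toL2 Ω 2 y - HSpace.toL2 Ω j (W τ)), ?_,
      fun s hs => ⟨?_, by simp⟩, by simp⟩
    · filter_upwards [h, ae_restrict_mem measurableSet_Ioi] with s h4 hs
      change η s = ∫ τ in (0 : ℝ)..s, -(W - constMemory Ω K j y : MemorySpace Ω K j) τ at h4
      rw [h4, hcomm s (le_of_lt hs), hcongr s (le_of_lt hs)]
    · simp only [heq]
      rw [intervalIntegrable_iff]
      exact (HSpace.toL2 Ω j).integrable_comp (intervalIntegrable_iff.1 (hint s hs))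

/-- Both sides of the weak equation are continuous in the test element for the `H_2` norm, so the
distributional identity extends from test functions to all of `H_2`. In particular `y` itself
becomes admissible. -/
theorem isImage_iff_isCoupledImage (U W : EnergySpace Ω K j) :
    IsImage U W ↔ IsCoupledImage (HSpace.toL2 Ω 2) (HSpace.inclusion Ω 1) (constMemory Ω K j)
      (derivGraph (HSpace Ω j) K) U W := by
  have key : ∀ (y : HSpace Ω 2) (φ : Test Ω),
      (pairing W.fst φ = Complex.I * pairing (HSpace.toL2 Ω 2 y) (lap Ω φ) -
        Complex.I * pairing (HSpace.toL2 Ω 2 y) (lap Ω (lap Ω φ)) +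
        (-1) ^ ((j : ℕ) + 1) * memoryPairing U.snd φ) ↔
      ⟪HSpace.toL2 Ω 2 (testH Ω 2 (conjTest φ)), W.fst⟫_ℂ =
        -Complex.I * ⟪HSpace.inclusion Ω 1 (testH Ω 2 (conjTest φ)), HSpace.inclusion Ω 1 y⟫_ℂ -
          Complex.I * ⟪testH Ω 2 (conjTest φ), y⟫_ℂ -
          ⟪constMemory Ω K j (testH Ω 2 (conjTest φ)), U.snd⟫_ℂ := by
    intro y φ
    have h1 := pairing_toL2_lap Ω 1 (HSpace.inclusion Ω 1 y) φ
    have h2 := pairing_toL2_lap Ω 2 y φ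
    rw [HSpace.toL2_inclusion] at h1
    change pairing (HSpace.toL2 Ω 2 y) (lap Ω φ) = (-1) ^ 1 * _ at h1
    change pairing (HSpace.toL2 Ω 2 y) (lap Ω (lap Ω φ)) = (-1) ^ 2 * _ at h2
    have h3 : ((-1 : ℂ)) ^ (j : ℕ) * (-1) ^ (j : ℕ) = 1 := by
      rw [← mul_pow]; simp
    rw [h1, h2, memoryPairing_eq_inner, pairing_eq_inner, toL2_testH, HSpace.inclusion_testH]
    have h4 : ∀ z : ℂ, (-1 : ℂ) ^ ((j : ℕ) + 1) * ((-1) ^ (j : ℕ) * z) = -z := fun z => by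
      rw [pow_succ]
      linear_combination (-z) * h3
    rw [h4]
    constructor <;> intro h <;> rw [h] <;> ring
  constructor
  · rintro ⟨⟨y, hy⟩, h2, h3⟩
    rw [← hy] at h2 h3
    refine ⟨y, hy.symm, fun φ => ?_, (hasDerivZeroTrace_iff y U.snd W.snd).1 h3⟩
    refine (denseRange_testH Ω 2).induction_on (p := fun φ => ⟪HSpace.toL2 Ω 2 φ, W.fst⟫_ℂ =
        -Complex.I * ⟪HSpace.inclusion Ω 1 φ, HSpace.inclusion Ω 1 y⟫_ℂ -
          Complex.I * ⟪φ, y⟫_ℂ - ⟪constMemory Ω K j φ, U.snd⟫_ℂ) φ ?_ fun χ => ?_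
    · refine isClosed_eq ((HSpace.toL2 Ω 2).continuous.inner continuous_const)
        (((continuous_const.mul ((HSpace.inclusion Ω 1).continuous.inner continuous_const)).sub
          (continuous_const.mul (continuous_id.inner continuous_const))).sub
          ((constMemory Ω K j).continuous.inner continuous_const))
    · have := (key y (conjTest χ)).1 (h2 _)
      rwa [conjTest_conjTest] at this
  · rintro ⟨y, hy, h2, h3⟩
    refine ⟨⟨y, hy.symm⟩, fun φ => ?_, ?_⟩
    · rw [hy]
      exact (key y φ).2 (h2 _)
    · rw [hy]
      exact (hasDerivZeroTrace_iff y U.snd W.snd).2 h3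

theorem isDissipative_opA (Ω : BoundedDomain d) (K : MemoryKernel) (j : Fin 3) :
    IsDissipative (opA Ω K j).graph := fun U W h =>
  ((isImage_iff_isCoupledImage U W).1 ((mem_graph_opA U W).1 h)).re_inner_nonpos
    isDissipative_derivGraph

theorem exists_mem_graph_opA {l : ℝ} (hl : 2 * ‖constMemory Ω K j‖ ^ 2 + 1 ≤ l)
    (Z : EnergySpace Ω K j) : ∃ U W, (U, W) ∈ (opA Ω K j).graph ∧ (l : ℂ) • U - W = Z := by
  have hl0 : 0 < l := lt_of_lt_of_le (by positivity) hl
  obtain ⟨U, W, h, e⟩ := exists_isCoupledImage (ι := HSpace.toL2 Ω 2)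
    (S := HSpace.inclusion Ω 1) isDissipative_derivGraph hl (exists_mem_derivGraph hl0) Z
  exact ⟨U, W, (mem_graph_opA U W).2 ((isImage_iff_isCoupledImage U W).2 h), e⟩

end Application

end BiharmonicMemory

end

theorem theoremA1 (d : ℕ) [NeZero d] (Ω : BoundedDomain d) (K : MemoryKernel) (j : Fin 3) :
    (∃ T : ℝ≥0 → EnergySpace Ω K j →L[ℂ] EnergySpace Ω K j,
      IsC0Semigroup T ∧ IsGenerator T (opA Ω K j)) ∧
    ∀ (n : ℕ) (U₀ : EnergySpace Ω K j), U₀ ∈ domPow (opA Ω K j) n →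
      ∃ U : ℝ → EnergySpace Ω K j,
        (InSmoothClass (opA Ω K j) n U ∧ IsSolution (opA Ω K j) n U₀ U) ∧
        ∀ V : ℝ → EnergySpace Ω K j,
          InSmoothClass (opA Ω K j) n V → IsSolution (opA Ω K j) n U₀ V →
            Set.EqOn V U (Set.Ici 0) := by
  have hA := isDissipative_opA Ω K j
  obtain ⟨T, hT, hgen, hTle, hint⟩ := hA.exists_semigroup
    (l₀ := 2 * ‖constMemory Ω K j‖ ^ 2 + 1) (by positivity) fun _ hl => exists_mem_graph_opA hl
  exact ⟨⟨T, hT, hgen⟩, hA.exists_unique_solution hT hgen hTle hint⟩
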